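/- Let $\pi$ be a Borel probability measure on $[0,\infty)$ with $\int u\,d\pi(u)<\infty$. For $s\in[0,\infty]$ let $T^\pi_s$ be the multitype Galton--Watson tree whose root has age $s$ and in which every vertex of age $r\in[0,\infty]$ independently has children whose ages form a Poisson random measure with intensity $(r\wedge u)\,d\pi(u)$ (that is, $u\,d\pi(u)$ when $r=\infty$); let $T^\pi$ be the tree constructed in the same way with a root age of law $\pi$, and let $|T|$ denote the number of vertices of $T$. Let $\mathcal L_\pi f(s)=\int_0^\infty f(u)(s\wedge u)\,d\pi(u)$ on $L^2(\pi)$, and suppose that $\pi$ is age-critical, i.e. that the operator norm satisfies $\|\mathcal L_\pi\|=1$. Then the following hold. (i) There are $r>0$ and functions $h_s:\{|\zeta|<r\}\to\mathbb C$, $s\in[0,\infty]$, each analytic, with $(s,\zeta)\mapsto h_s(\zeta)$ jointly continuous on $[0,\infty]\times\{|\zeta|<r\}$, such that $$\mathbb E\bigl(z^{|T^\pi_s|}\bigr)=h_s\bigl(\sqrt{1-z}\bigr)\qquad\text{for all } s\in[0,\infty] \text{ and all } z\in\mathbb C \text{ with } |z|<1,\ |1-z|<r^2,$$ where $\sqrt{\cdot}$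 is the principal branch. (ii) There is a unique function $\theta:[0,\infty]\to\mathbb R$ with $\theta\in L^2(\pi)$, $\theta(s)=\int_0^\infty\theta(u)(u\wedge s)\,d\pi(u)$ for all $s\in[0,\infty)$, $\int\theta\,d\pi=1$ and $\theta(\infty)=\lim_{s\to\infty}\theta(s)$ (the principal eigenfunction of $\mathcal L_\pi$). The function $\theta^3$ is $\pi$-integrable with $\int\theta^3\,d\pi>0$, and with $\phi:=\bigl(\int\theta^3\,d\pi\bigr)^{-1}$ one has, as $z\nearrow1$ through the reals, $$\mathbb E\bigl(z^{|T^\pi_s|}\bigr)=1-\sqrt{2\phi}\,\theta(s)\sqrt{1-z}+O(1-z)$$ with an implied constant and a range of $z$ that are uniform in $s\in[0,\infty]$, and $$\mathbb E\bigl(z^{|T^\pi|}\bigr)=1-\sqrt{2\phi}\,\sqrt{1-z}+O(1-z).$$ -/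

import Mathlib

open MeasureTheory ProbabilityTheory Filter Topology Set
open scoped ENNReal NNReal

namespace AgeTree

/-- Finite sequences carry the `σ`-algebra of the disjoint union of the powers `αⁿ`: a set of lists
is measurable when its trace on each `αⁿ` is. -/
instance listMeasurableSpace {α : Type*} [MeasurableSpace α] : MeasurableSpace (List α) :=
  ⨅ n : ℕ, MeasurableSpace.map (fun x : Fin n → α => List.ofFn x) inferInstance

theorem measurableSet_list {α : Type*} [MeasurableSpace α] {s : Set (List α)} :
    MeasurableSet s ↔ ∀ n : ℕ, MeasurableSet ((fun x : Fin n → α => List.ofFn x) ⁻¹' s) := by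
  simp only [MeasurableSpace.measurableSet_iInf]
  rfl

theorem measurable_ofFn {α : Type*} [MeasurableSpace α] (n : ℕ) :
    Measurable (fun x : Fin n → α => List.ofFn x) :=
  fun _ hs => measurableSet_list.1 hs n

theorem measurable_of_ofFn {α γ : Type*} [MeasurableSpace α] [MeasurableSpace γ]
    {f : List α → γ} (h : ∀ n : ℕ, Measurable (fun x : Fin n → α => f (List.ofFn x))) :
    Measurable f :=
  fun _ hs => measurableSet_list.2 fun n => h n hs

theorem measurable_length {α : Type*} [MeasurableSpace α] :
    Measurable (List.length : List α → ℕ) := by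
  refine measurable_of_ofFn fun n => ?_
  simp

theorem measurable_getD {α : Type*} [MeasurableSpace α] (i : ℕ) (d : α) :
    Measurable (fun l : List α => l.getD i d) := by
  refine measurable_of_ofFn fun n => ?_
  by_cases h : i < n
  · have : (fun x : Fin n → α => (List.ofFn x).getD i d) = fun x => x ⟨i, h⟩ := by
      funext x
      simp [h]
    rw [this]
    exact measurable_pi_apply _
  · have : (fun x : Fin n → α => (List.ofFn x).getD i d) = fun _ => d := by
      funext x
      simp [h]
    rw [this]
    exact measurable_const

theorem measurable_append {α : Type*} [MeasurableSpace α] [Inhabited α] :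
    Measurable (fun p : List α × List α => p.1 ++ p.2) := by
  have key : ∀ mn : ℕ × ℕ, MeasurableSet {p : List α × List α |
      p.1.length = mn.1 ∧ p.2.length = mn.2} := fun mn =>
    ((measurable_length.comp measurable_fst) (measurableSet_singleton mn.1)).inter
      ((measurable_length.comp measurable_snd) (measurableSet_singleton mn.2))
  intro s hs
  have hcover : (fun p : List α × List α => p.1 ++ p.2) ⁻¹' s = ⋃ mn : ℕ × ℕ,
      ({p : List α × List α | p.1.length = mn.1 ∧ p.2.length = mn.2} ∩
        (fun p : List α × List α => List.ofFn (fun i : Fin (mn.1 + mn.2) =>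
          if (i : ℕ) < mn.1 then p.1.getD i default else p.2.getD (i - mn.1) default)) ⁻¹' s) := by
    ext p
    have hp : List.ofFn (fun i : Fin (p.1.length + p.2.length) =>
        if (i : ℕ) < p.1.length then p.1.getD i default
          else p.2.getD (i - p.1.length) default) = p.1 ++ p.2 := by
      apply List.ext_getElem
      · simp
      · intro i h1 h2
        simp only [List.length_append] at h2
        simp only [List.getElem_ofFn, List.getElem_append]
        split_ifs with h
        · simp [h]
        · have : i - p.1.length < p.2.length := by omega
          simp [this]
    simp only [mem_iUnion, mem_inter_iff, mem_preimage, Set.mem_ofPred_eq]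
    constructor
    · intro h
      exact ⟨(p.1.length, p.2.length), ⟨rfl, rfl⟩, by rw [hp]; exact h⟩
    · rintro ⟨⟨m, n⟩, ⟨h1, h2⟩, h⟩
      simp only at h1 h2
      subst h1 h2
      rw [hp] at h
      exact h
  rw [hcover]
  refine MeasurableSet.iUnion fun mn => (key mn).inter ?_
  refine ((measurable_ofFn (mn.1 + mn.2)).comp (measurable_pi_lambda _ fun i => ?_)) hs
  by_cases h : (i : ℕ) < mn.1
  · simp only [h, if_true]
    exact (measurable_getD _ _).comp measurable_fst
  · simp only [h, if_false]
    exact (measurable_getD _ _).comp measurable_snd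

theorem measurable_flatten {α : Type*} [MeasurableSpace α] [Inhabited α] :
    Measurable (List.flatten : List (List α) → List α) := by
  refine measurable_of_ofFn fun n => ?_
  induction n with
  | zero => simp
  | succ n ih =>
    have : (fun x : Fin (n + 1) → List α => (List.ofFn x).flatten) =
        fun x => (fun p : List α × List α => p.1 ++ p.2)
          (x 0, (List.ofFn (fun i : Fin n => x i.succ)).flatten) := by
      funext x
      simp [List.ofFn_succ]
    rw [this]
    refine measurable_append.comp ((measurable_pi_apply 0).prodMk ?_)
    exact ih.comp (measurable_pi_lambda _ fun i => measurable_pi_apply _)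

theorem measurable_measure_pi {α β : Type*} [MeasurableSpace α] [MeasurableSpace β] {n : ℕ}
    (μ : Fin n → α → Measure β) [∀ i a, IsFiniteMeasure (μ i a)] (hμ : ∀ i, Measurable (μ i)) :
    Measurable fun a => Measure.pi fun i => μ i a := by
  refine Measurable.measure_of_isPiSystem generateFrom_pi.symm isPiSystem_pi ?_ ?_
  · rintro _ ⟨t, ht, rfl⟩
    simp only [Measure.pi_pi]
    exact Finset.measurable_prod _ fun i _ =>
      (Measure.measurable_coe (ht i (mem_univ i))).comp (hμ i)
  · simp only [Measure.pi_univ]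
    exact Finset.measurable_prod _ fun i _ =>
      (Measure.measurable_coe MeasurableSet.univ).comp (hμ i)

/-- Given a list `a₁, …, aₙ`, the law of a list `b₁, …, bₙ` of independent entries in which `bᵢ`
has law `κ aᵢ`. -/
noncomputable def listKernel {α β : Type*} [MeasurableSpace α] [MeasurableSpace β]
    (κ : Kernel α β) [IsMarkovKernel κ] : Kernel (List α) (List β) where
  toFun l := (Measure.pi fun i : Fin l.length => κ (l.get i)).map List.ofFn
  measurable' := by
    refine measurable_of_ofFn fun n => ?_
    have key : ∀ (l : List α) (x : Fin n → α) (h : l = List.ofFn x),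
        (Measure.pi fun i : Fin l.length => κ (l.get i)).map List.ofFn =
          (Measure.pi fun i : Fin n => κ (x i)).map List.ofFn := by
      intro l x h
      have hn : l.length = n := by rw [h]; simp
      subst hn
      have : x = l.get := by
        apply List.ofFn_injective
        rw [← h]
        simp
      rw [this]
    have : (fun x : Fin n → α => (Measure.pi fun i : Fin (List.ofFn x).length =>
        κ ((List.ofFn x).get i)).map List.ofFn) =
        fun x => (Measure.pi fun i : Fin n => κ (x i)).map List.ofFn :=
      funext fun x => key _ x rfl
    rw [this]
    refine (Measure.measurable_map _ (measurable_ofFn n)).comp ?_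
    exact measurable_measure_pi (fun i (x : Fin n → α) => κ (x i))
      fun i => κ.measurable.comp (measurable_pi_apply i)

instance {α β : Type*} [MeasurableSpace α] [MeasurableSpace β]
    (κ : Kernel α β) [IsMarkovKernel κ] : IsMarkovKernel (listKernel κ) :=
  ⟨fun _ => Measure.isProbabilityMeasure_map (measurable_ofFn _).aemeasurable⟩

/-- The law of a Poisson random measure (Poisson point process) with finite intensity measure `μ`.
A configuration is recorded as the list of its points: with probability
`e^{-m} mᵏ / k!`, where `m` is the total mass of `μ`, there are `k` points, and these are
independent with law `μ / m`. -/
noncomputable def poissonProcess {α : Type*} [MeasurableSpace α] (μ : Measure α) :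
    Measure (List α) :=
  Measure.sum fun k : ℕ =>
    ENNReal.ofReal (Real.exp (-μ.real univ) / (k.factorial : ℝ)) •
      (Measure.pi fun _ : Fin k => μ).map List.ofFn

theorem isProbabilityMeasure_poissonProcess {α : Type*} [MeasurableSpace α] (μ : Measure α)
    [IsFiniteMeasure μ] : IsProbabilityMeasure (poissonProcess μ) := by
  constructor
  rw [poissonProcess, Measure.sum_apply _ MeasurableSet.univ]
  have hk : ∀ k : ℕ, (ENNReal.ofReal (Real.exp (-μ.real univ) / (k.factorial : ℝ)) •
      (Measure.pi fun _ : Fin k => μ).map List.ofFn) univ =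
      ENNReal.ofReal (Real.exp (-μ.real univ) * (μ.real univ ^ k / (k.factorial : ℝ))) := by
    intro k
    rw [Measure.smul_apply, Measure.map_apply (measurable_ofFn k) MeasurableSet.univ, preimage_univ,
      Measure.pi_univ, Finset.prod_const, Finset.card_univ, Fintype.card_fin, smul_eq_mul,
      ← ENNReal.ofReal_toReal (measure_ne_top μ univ), ← ENNReal.ofReal_pow ENNReal.toReal_nonneg,
      ← ENNReal.ofReal_mul (by positivity), Measure.real]
    congr 1
    ring
  have hs : HasSum (fun k : ℕ => Real.exp (-μ.real univ) * (μ.real univ ^ k / (k.factorial : ℝ)))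
      1 := by
    have := (NormedSpace.expSeries_div_hasSum_exp (μ.real univ)).mul_left (Real.exp (-μ.real univ))
    rwa [← Real.exp_eq_exp_ℝ, ← Real.exp_add, neg_add_cancel, Real.exp_zero] at this
  simp_rw [hk]
  rw [← ENNReal.ofReal_tsum_of_nonneg (fun k => by positivity) hs.summable, hs.tsum_eq,
    ENNReal.ofReal_one]

/-- A measure `π` on the ages `[0, ∞)` with `∫ u dπ(u) < ∞`. -/
class HasFiniteMean (π : Measure ℝ≥0) : Prop where
  lintegral_lt_top : ∫⁻ u, (u : ℝ≥0∞) ∂π < ∞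

/-- The intensity `(s ∧ u) dπ(u)` of the ages of the children of a vertex of age `s ∈ [0, ∞]`
(for `s = ∞` this is `u dπ(u)`), as a measure on `[0, ∞]`. -/
noncomputable def intensity (π : Measure ℝ≥0) (s : ℝ≥0∞) : Measure ℝ≥0∞ :=
  (π.withDensity fun u => min s (u : ℝ≥0∞)).map (fun u : ℝ≥0 => (u : ℝ≥0∞))

instance (π : Measure ℝ≥0) [HasFiniteMean π] (s : ℝ≥0∞) : IsFiniteMeasure (intensity π s) := by
  constructor
  rw [intensity, Measure.map_apply measurable_coe_nnreal_ennreal MeasurableSet.univ, preimage_univ,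
    withDensity_apply _ MeasurableSet.univ, Measure.restrict_univ]
  exact (lintegral_mono fun u => min_le_right _ _).trans_lt HasFiniteMean.lintegral_lt_top

theorem measurable_intensity (π : Measure ℝ≥0) [IsProbabilityMeasure π] :
    Measurable (intensity π) := by
  refine (Measure.measurable_map _ measurable_coe_nnreal_ennreal).comp ?_
  refine Measure.measurable_of_measurable_coe _ fun t ht => ?_
  simp only [withDensity_apply _ ht]
  refine Measurable.lintegral_prod_right (f := fun (s : ℝ≥0∞) (u : ℝ≥0) => min s (u : ℝ≥0∞)) ?_
  exact measurable_fst.min (measurable_coe_nnreal_ennreal.comp measurable_snd)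

/-- The law of the list of ages of the children of a vertex, given the age of that vertex. -/
noncomputable def offspring (π : Measure ℝ≥0) [IsProbabilityMeasure π] [HasFiniteMean π] :
    Kernel ℝ≥0∞ (List ℝ≥0∞) where
  toFun s := poissonProcess (intensity π s)
  measurable' := by
    refine Measure.measurable_of_measurable_coe _ fun t ht => ?_
    simp only [poissonProcess, Measure.sum_apply _ ht, Measure.smul_apply, smul_eq_mul]
    refine Measurable.tsum fun k => ?_
    refine Measurable.mul ?_ ?_
    · refine ENNReal.measurable_ofReal.comp ((Real.measurable_exp.comp ?_).div_const _)
      exact (ENNReal.measurable_toReal.comp ((Measure.measurable_coe MeasurableSet.univ).comp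
        (measurable_intensity π))).neg
    · exact (Measure.measurable_coe ht).comp ((Measure.measurable_map _ (measurable_ofFn k)).comp
        (measurable_measure_pi (fun _ => intensity π) fun _ => measurable_intensity π))

instance (π : Measure ℝ≥0) [IsProbabilityMeasure π] [HasFiniteMean π] :
    IsMarkovKernel (offspring π) :=
  ⟨fun s => isProbabilityMeasure_poissonProcess (intensity π s)⟩

/-- One generation of a rooted plane tree with ages: the list of sibships, in the order of the
parents in the previous generation, each sibship being the list of the ages of its members.
The vertices of the generation, in order, are the entries of the flattened list. A sequence
`x : ℕ → Generation` with `x 0` a single sibship with a single member thus describes a rooted tree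
with ages: the children of the `i`-th vertex of `x n` are the members of the `i`-th sibship of
`x (n + 1)`. -/
abbrev Generation : Type := List (List ℝ≥0∞)

/-- The law of generation `n + 1` given the generations `0, …, n`: the vertices of generation `n`
have independent sets of children, those of a vertex of age `s` being distributed as
`offspring π s`. -/
noncomputable def nextGeneration (π : Measure ℝ≥0) [IsProbabilityMeasure π] [HasFiniteMean π]
    (n : ℕ) : Kernel ((_ : Finset.Iic n) → Generation) Generation :=
  (listKernel (offspring π)).comap
    (fun x => (x ⟨n, Finset.mem_Iic.2 le_rfl⟩).flatten)
    (measurable_flatten.comp (measurable_pi_apply _))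

instance (π : Measure ℝ≥0) [IsProbabilityMeasure π] [HasFiniteMean π] (n : ℕ) :
    IsMarkovKernel (nextGeneration π n) := by
  unfold nextGeneration
  infer_instance

/-- The law of the multitype Galton-Watson tree with ages whose root has an age with law `ν`. -/
noncomputable def treeLaw (π : Measure ℝ≥0) [IsProbabilityMeasure π] [HasFiniteMean π]
    (ν : Measure ℝ≥0∞) : Measure (ℕ → Generation) :=
  Kernel.trajMeasure (X := fun _ => Generation) (ν.map fun s => [[s]]) (nextGeneration π)

/-- The law of the tree `T^π_s` with root of age `s ∈ [0, ∞]`. -/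
noncomputable def treeLawFrom (π : Measure ℝ≥0) [IsProbabilityMeasure π] [HasFiniteMean π]
    (s : ℝ≥0∞) : Measure (ℕ → Generation) :=
  treeLaw π (Measure.dirac s)

/-- The law of the tree `T^π`, whose root has an age with law `π`. -/
noncomputable def treeLawStat (π : Measure ℝ≥0) [IsProbabilityMeasure π] [HasFiniteMean π] :
    Measure (ℕ → Generation) :=
  treeLaw π (π.map fun u : ℝ≥0 => (u : ℝ≥0∞))

/-- The vertices of a tree: `(n, i)` is the `i`-th vertex of generation `n`. -/
def vertices (x : ℕ → Generation) : Set (ℕ × ℕ) :=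
  {p | p.2 < (x p.1).flatten.length}

/-- `|T|`, the total number of vertices, possibly infinite. -/
noncomputable def size (x : ℕ → Generation) : ℕ∞ := (vertices x).encard

/-- `zᵏ` for `k ∈ ℕ ∪ {∞}`, with `z^∞ = 0`, as appropriate for `|z| < 1`. -/
noncomputable def powENat (z : ℂ) (k : ℕ∞) : ℂ := if k = ⊤ then 0 else z ^ k.toNat

/-- `E z^{|T|}` for a random tree `T` with law `P`, where `|z| < 1`. -/
noncomputable def genFun (P : Measure (ℕ → Generation)) (z : ℂ) : ℂ :=
  ∫ x, powENat z (size x) ∂P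

/-- The branching operator `(L_π f)(s) = ∫ f(u) (s ∧ u) dπ(u)`. -/
noncomputable def branchingOp (π : Measure ℝ≥0) (f : ℝ≥0 → ℝ) (s : ℝ≥0) : ℝ :=
  ∫ u, f u * (min s u : ℝ≥0) ∂π

/-- The operator norm of `L_π` on `L²(π)`, with values in `[0, ∞]`. -/
noncomputable def branchingOpNorm (π : Measure ℝ≥0) : ℝ≥0∞ :=
  ⨆ (f : ℝ≥0 → ℝ) (_ : MemLp f 2 π) (_ : eLpNorm f 2 π ≤ 1), eLpNorm (branchingOp π f) 2 π

/-- `π` is age-critical: `‖L_π‖ = 1`. -/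
def AgeCritical (π : Measure ℝ≥0) : Prop := branchingOpNorm π = 1

/-- `θ` is the principal eigenfunction of `L_π`: it lies in `L²(π)`, satisfies `L_π θ = λ θ` with
`λ = ‖L_π‖` (everywhere on `[0, ∞)`, which selects the Lipschitz representative), has
`∫ θ dπ = 1`, and is extended to `∞` by `θ(∞) = lim_{s → ∞} θ(s)`. -/
structure IsPrincipalEigenfunction (π : Measure ℝ≥0) (θ : ℝ≥0∞ → ℝ) : Prop where
  memLp : MemLp (fun u : ℝ≥0 => θ u) 2 π
  eigen : ∀ s : ℝ≥0, branchingOp π (fun u => θ u) s = (branchingOpNorm π).toReal * θ s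
  integral_eq_one : ∫ u : ℝ≥0, θ u ∂π = 1
  tendsto_top : Tendsto (fun s : ℝ≥0 => θ s) atTop (𝓝 (θ ∞))

/-- `φ = (∫ θ³ dπ)⁻¹`. -/
noncomputable def phi (π : Measure ℝ≥0) (θ : ℝ≥0∞ → ℝ) : ℝ := (∫ u : ℝ≥0, θ u ^ 3 ∂π)⁻¹

end AgeTree

/-! Write `G_s(z)` for the generating function of the size of the tree with root age `s`, and `L`
for `ageOp π`. Integrating out one generation at a time with the Poisson generating functional gives
`G = z exp (L (G - 1))` (`integral_generation_succ`, `genFun_eq`). With `y = L (1 - G)` and `z = 1 -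
ε` this becomes `y = L (1 - (1 - ε) e^{-y})`, an equation in the Banach algebra of continuous
functions on `[0, ∞]`, on which `L` is compact (`isCompactOperator_ageCLM`). Working in this space
makes all later estimates uniform in `s`.

Criticality is a statement about `L²(π)` and has to be transferred. If the powers of `L` decayed
geometrically in sup norm, then, because `L` is symmetric and `n ↦ ‖Lⁿ f‖²` is therefore log-convex,
the `L²` norm of `L` would be less than 1 (`branchingOpNorm_lt_one_of_norm_pow_le`). So there is an
eigenvector with eigenvalue of modulus at least 1. Its absolute value `f` satisfies `f ≤ L f`, hence
`f = L f` almost everywhere since `L` does not increase `L²` norms (`ageOp_ae_eq_of_le`). This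
produces `θ`; positivity of the kernel makes the eigenvalue 1 simple (`eq_zero_of_ageOp_eq`), which
also yields uniqueness.

Pairing the equation for the survival probability with `θ` shows that the tree is almost surely
finite (`IsPositiveEigenfunction.finiteProb_eq_one`), so `y` tends to 0 uniformly as `z → 1` inside
the disc.

Near `(0, 0)` the derivative `1 - L` in `y` is singular, but adjoining the coordinate `ℓ y = ∫ y θ
dπ` makes the linearised system in `(y, ε)` invertible. The inverse function theorem gives an
analytic curve of solutions parametrised by `a = ℓ y` (`exists_solution_curve`). Applying `ℓ` to the
equation removes `L` and leaves `ε ℓ(e^{-y}) = ℓ(e^{-y} - 1 + y)`, so `ε = a² E(a)` with `E(0) ≠ 0`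
(`exists_eq_sq_mul`). Hence `a` is an analytic function of a square root of `ε`, and the sign of the
root is fixed by `Re ℓ y ≥ 0` (`exists_analytic_solution`). The value `E(0)` produces the constant
`√(2φ)`. -/

namespace AgeTree

/-! ### Product functionals of random lists. -/

section Lists

variable {α β : Type*} [MeasurableSpace α] [MeasurableSpace β]

theorem measurable_list_map_prod {f : α → ℂ} (hf : Measurable f) :
    Measurable fun l : List α => (l.map f).prod := by
  refine measurable_of_ofFn fun n => ?_
  simp only [List.map_ofFn, List.prod_ofFn, Function.comp_def]
  exact Finset.measurable_prod _ fun i _ => hf.comp (measurable_pi_apply i)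

omit [MeasurableSpace α] in
theorem norm_list_map_prod_le_one {f : α → ℂ} (hf : ∀ a, ‖f a‖ ≤ 1) (l : List α) :
    ‖(l.map f).prod‖ ≤ 1 := by
  induction l with
  | nil => simp
  | cons a l ih =>
    simp only [List.map_cons, List.prod_cons, norm_mul]
    exact mul_le_one₀ (hf a) (norm_nonneg _) ih

theorem integral_map_ofFn_prod (n : ℕ) (μ : Fin n → Measure α) [∀ i, IsFiniteMeasure (μ i)]
    {f : α → ℂ} (hf : Measurable f) :
    ∫ l, (l.map f).prod ∂(Measure.pi μ).map List.ofFn = ∏ i, ∫ a, f a ∂μ i := by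
  rw [integral_map (measurable_ofFn n).aemeasurable
    (measurable_list_map_prod hf).aestronglyMeasurable]
  simp only [List.map_ofFn, List.prod_ofFn, Function.comp_def]
  exact integral_fintype_prod_eq_prod (fun _ => f)

theorem integral_listKernel (κ : Kernel α β) [IsMarkovKernel κ] {f : β → ℂ} (hf : Measurable f)
    (l : List α) :
    ∫ m, (m.map f).prod ∂listKernel κ l = (l.map fun a => ∫ b, f b ∂κ a).prod := by
  change ∫ m, (m.map f).prod ∂(Measure.pi fun i : Fin l.length => κ (l.get i)).map List.ofFn = _
  rw [integral_map_ofFn_prod _ _ hf]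
  conv_rhs => rw [← List.ofFn_get l, List.map_ofFn, List.prod_ofFn]
  rfl

/-- The probability generating functional of a Poisson random measure. -/
theorem integral_poissonProcess (μ : Measure α) [IsFiniteMeasure μ] {f : α → ℂ}
    (hf : Measurable f) (hf1 : ∀ a, ‖f a‖ ≤ 1) :
    ∫ l, (l.map f).prod ∂(poissonProcess μ) = Complex.exp (∫ a, (f a - 1) ∂μ) := by
  have hprob := isProbabilityMeasure_poissonProcess μ
  have hint : Integrable (fun l : List α => (l.map f).prod) (poissonProcess μ) :=
    Integrable.of_bound (measurable_list_map_prod hf).aestronglyMeasurable 1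
      (ae_of_all _ fun l => norm_list_map_prod_le_one hf1 l)
  have hfi : Integrable f μ :=
    Integrable.of_bound hf.aestronglyMeasurable 1 (ae_of_all _ hf1)
  have h1 : HasSum (fun k : ℕ => ((Real.exp (-μ.real univ) / k.factorial : ℝ) : ℂ) *
      (∫ a, f a ∂μ) ^ k) (∫ l, (l.map f).prod ∂(poissonProcess μ)) := by
    have := hasSum_integral_measure (f := fun l : List α => (l.map f).prod) hint
    refine this.congr_fun fun k => ?_
    rw [integral_smul_measure, integral_map_ofFn_prod _ _ hf,
      ENNReal.toReal_ofReal (by positivity)]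
    simp
  have h2 : HasSum (fun k : ℕ => ((Real.exp (-μ.real univ) / k.factorial : ℝ) : ℂ) *
      (∫ a, f a ∂μ) ^ k) (Complex.exp (∫ a, (f a - 1) ∂μ)) := by
    rw [integral_sub hfi (integrable_const _), sub_eq_neg_add, Complex.exp_add]
    have := (NormedSpace.expSeries_div_hasSum_exp (∫ a, f a ∂μ)).mul_left
      (Complex.exp (-μ.real univ))
    rw [← Complex.exp_eq_exp_ℂ] at this
    convert! this using 2
    · push_cast
      ring
    · simp
  exact h1.unique h2

end Lists

/-- The operator `L_π` on functions with values in a Banach space, with `s` ranging over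
`[0, ∞]`. -/
noncomputable def ageOp {E : Type*} [NormedAddCommGroup E] [NormedSpace ℝ E] (π : Measure ℝ≥0)
    (f : ℝ≥0 → E) (s : ℝ≥0∞) : E :=
  ∫ u, (min s (u : ℝ≥0∞)).toReal • f u ∂π

/-! ### The kernel `s ∧ u` and continuity of `L_π f` on `[0, ∞]`. -/

section Kernel

variable {E : Type*} [NormedAddCommGroup E] [NormedSpace ℝ E]

theorem toReal_min_le (s : ℝ≥0∞) (u : ℝ≥0) : (min s (u : ℝ≥0∞)).toReal ≤ u :=
  ENNReal.toReal_le_of_le_ofReal u.2 (by simp)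

theorem continuous_toReal_min (u : ℝ≥0) : Continuous fun s : ℝ≥0∞ => (min s (u : ℝ≥0∞)).toReal :=
  continuous_iff_continuousAt.2 fun s =>
    (ENNReal.tendsto_toReal (by simp)).comp
      (continuous_id.min continuous_const).continuousAt

theorem measurable_toReal_min :
    Measurable fun p : ℝ≥0∞ × ℝ≥0 => (min p.1 (p.2 : ℝ≥0∞)).toReal :=
  (measurable_fst.min (measurable_coe_nnreal_ennreal.comp measurable_snd)).ennreal_toReal

theorem integrable_coe (π : Measure ℝ≥0) [HasFiniteMean π] :
    Integrable (fun u : ℝ≥0 => (u : ℝ)) π := by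
  refine ⟨measurable_coe_nnreal_real.aestronglyMeasurable, ?_⟩
  rw [HasFiniteIntegral]
  simpa [enorm_eq_nnnorm] using HasFiniteMean.lintegral_lt_top (π := π)

theorem norm_smul_min_le {f : ℝ≥0 → E} {C : ℝ} (hC : ∀ u, ‖f u‖ ≤ C) (s : ℝ≥0∞) (u : ℝ≥0) :
    ‖(min s (u : ℝ≥0∞)).toReal • f u‖ ≤ C * u := by
  rw [norm_smul, Real.norm_of_nonneg ENNReal.toReal_nonneg, mul_comm]
  exact mul_le_mul (hC u) (toReal_min_le s u) ENNReal.toReal_nonneg ((norm_nonneg _).trans (hC u))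

theorem integrable_smul_min (π : Measure ℝ≥0) [HasFiniteMean π] {f : ℝ≥0 → E} {C : ℝ}
    (hf : AEStronglyMeasurable f π) (hC : ∀ u, ‖f u‖ ≤ C) (s : ℝ≥0∞) :
    Integrable (fun u : ℝ≥0 => (min s (u : ℝ≥0∞)).toReal • f u) π := by
  refine ((integrable_coe π).const_mul C).mono' ?_ (ae_of_all _ (norm_smul_min_le hC s))
  exact (measurable_toReal_min.comp measurable_prodMk_left).aestronglyMeasurable.smul hf

theorem continuous_ageOp (π : Measure ℝ≥0) [HasFiniteMean π] {f : ℝ≥0 → E} {C : ℝ}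
    (hf : AEStronglyMeasurable f π) (hC : ∀ u, ‖f u‖ ≤ C) : Continuous (ageOp π f) :=
  continuous_of_dominated (fun s => (integrable_smul_min π hf hC s).aestronglyMeasurable)
    (fun s => ae_of_all _ (norm_smul_min_le hC s)) ((integrable_coe π).const_mul C)
    (ae_of_all _ fun u => (continuous_toReal_min u).smul continuous_const)

theorem integral_intensity (π : Measure ℝ≥0) [IsProbabilityMeasure π] {f : ℝ≥0∞ → ℂ}
    (hf : Measurable f) (s : ℝ≥0∞) :
    ∫ u, f u ∂intensity π s = ageOp π (fun u => f u) s := by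
  rw [intensity, integral_map measurable_coe_nnreal_ennreal.aemeasurable hf.aestronglyMeasurable,
    integral_withDensity_eq_integral_toReal_smul]
  · rfl
  · exact measurable_const.min measurable_coe_nnreal_ennreal
  · exact ae_of_all _ fun u => (min_le_right _ _).trans_lt ENNReal.coe_lt_top

end Kernel

/-! ### Recursion over the generations of the tree. -/

section Trees

variable (π : Measure ℝ≥0) [IsProbabilityMeasure π] [HasFiniteMean π]

/-- The `f`-weighted product over the children of a vertex of age `s`, in expectation. -/
noncomputable def offspringFun (f : ℝ≥0∞ → ℂ) (s : ℝ≥0∞) : ℂ :=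
  Complex.exp (ageOp π (fun u => f u - 1) s)

theorem integral_offspring {f : ℝ≥0∞ → ℂ} (hf : Measurable f) (hf1 : ∀ a, ‖f a‖ ≤ 1)
    (s : ℝ≥0∞) : ∫ l, (l.map f).prod ∂offspring π s = offspringFun π f s := by
  change ∫ l, (l.map f).prod ∂(poissonProcess (intensity π s)) = _
  rw [integral_poissonProcess _ hf hf1, offspringFun,
    integral_intensity π (f := fun u => f u - 1) (hf.sub_const 1)]

theorem norm_offspringFun_le_one {f : ℝ≥0∞ → ℂ} (hf : Measurable f) (hf1 : ∀ a, ‖f a‖ ≤ 1)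
    (s : ℝ≥0∞) : ‖offspringFun π f s‖ ≤ 1 := by
  rw [← integral_offspring π hf hf1 s]
  refine (norm_integral_le_of_norm_le_const (C := 1)
    (ae_of_all _ fun l => norm_list_map_prod_le_one hf1 l)).trans ?_
  simp

omit [IsProbabilityMeasure π] in
theorem measurable_offspringFun {f : ℝ≥0∞ → ℂ} (hf : Measurable f) (hf1 : ∀ a, ‖f a‖ ≤ 1) :
    Measurable (offspringFun π f) := by
  refine (Complex.continuous_exp.comp (continuous_ageOp π (C := 2) ?_ fun u => ?_)).measurable
  · exact ((hf.comp measurable_coe_nnreal_ennreal).sub_const 1).aestronglyMeasurable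
  · calc ‖f u - 1‖ ≤ ‖f u‖ + ‖(1 : ℂ)‖ := norm_sub_le _ _
      _ ≤ 2 := by rw [norm_one]; linarith [hf1 u]

theorem measurable_cons_nil {α : Type*} [MeasurableSpace α] : Measurable fun a : α => [a] := by
  have : (fun a : α => [a]) = fun a => List.ofFn (fun _ : Fin 1 => a) := by
    funext a
    simp
  rw [this]
  exact (measurable_ofFn 1).comp (measurable_pi_lambda _ fun _ => measurable_id)

theorem measurable_root : Measurable fun s : ℝ≥0∞ => ([[s]] : Generation) :=
  measurable_cons_nil.comp measurable_cons_nil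

instance (ν : Measure ℝ≥0∞) [IsProbabilityMeasure ν] : IsProbabilityMeasure (treeLaw π ν) := by
  have : IsProbabilityMeasure (ν.map fun s => [[s]]) :=
    Measure.isProbabilityMeasure_map
      measurable_root.aemeasurable
  unfold treeLaw
  infer_instance

variable (ν : Measure ℝ≥0∞) [IsProbabilityMeasure ν]

omit [IsProbabilityMeasure ν] in
theorem map_eval_zero_treeLaw : (treeLaw π ν).map (fun x => x 0) = ν.map fun s => [[s]] := by
  have h0 : (fun x : ℕ → Generation => x 0) =
      (fun y : ((i : Finset.Iic 0) → Generation) => y ⟨0, by simp⟩) ∘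
        Preorder.frestrictLe 0 := rfl
  have hm : Measurable fun y : ((i : Finset.Iic 0) → Generation) => y ⟨0, by simp⟩ :=
    measurable_pi_apply _
  rw [h0, ← Measure.map_map hm (Preorder.measurable_frestrictLe 0), treeLaw,
    Kernel.trajMeasure, Measure.map_comp _ _ (Preorder.measurable_frestrictLe 0),
    Kernel.traj_map_frestrictLe, Kernel.partialTraj_self, Measure.id_comp,
    Measure.map_map hm (MeasurableEquiv.measurable _)]
  exact Measure.map_id

/-- The number of vertices in the first `n` generations. -/
def partialSize (n : ℕ) (x : ℕ → Generation) : ℕ :=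
  ∑ k ∈ Finset.range n, (x k).flatten.length

theorem measurable_partialSize (n : ℕ) : Measurable (partialSize n) :=
  Finset.measurable_sum _ fun k _ =>
    measurable_length.comp (measurable_flatten.comp (measurable_pi_apply k))

omit [IsProbabilityMeasure ν] in
theorem integral_generation_zero {f : ℝ≥0∞ → ℂ} (hf : Measurable f) :
    ∫ x, ((x 0).flatten.map f).prod ∂treeLaw π ν = ∫ s, f s ∂ν := by
  have hm : Measurable fun g : Generation => (g.flatten.map f).prod :=
    (measurable_list_map_prod hf).comp measurable_flatten
  have h0 : Measurable fun x : ℕ → Generation => x 0 := measurable_pi_apply 0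
  rw [← integral_map (f := fun g : Generation => (g.flatten.map f).prod)
      h0.aemeasurable hm.aestronglyMeasurable, map_eval_zero_treeLaw,
    integral_map measurable_root.aemeasurable
      hm.aestronglyMeasurable]
  simp

/-- Branching property: given generations `0, …, n`, the sibships of generation `n + 1` are
independent, so the product over that generation integrates to a product of `offspringFun π f` over
generation `n`. The factor `z` per vertex accounts for the difference between `partialSize (n + 1)`
and `partialSize n`. -/
theorem integral_generation_succ {z : ℂ} (hz : ‖z‖ ≤ 1) {f : ℝ≥0∞ → ℂ} (hf : Measurable f)
    (hf1 : ∀ a, ‖f a‖ ≤ 1) (n : ℕ) :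
    ∫ x, z ^ partialSize (n + 1) x * ((x (n + 1)).flatten.map f).prod ∂treeLaw π ν =
      ∫ x, z ^ partialSize n x *
        ((x n).flatten.map fun s => z * offspringFun π f s).prod ∂treeLaw π ν := by
  have hprob : IsProbabilityMeasure (ν.map fun s => [[s]]) :=
    Measure.isProbabilityMeasure_map
      measurable_root.aemeasurable
  -- `partialSize (n + 1)` counts generations `0, …, n` only, so this weight is a function of the
  -- past and comes out of the inner integral.
  let W : ((i : Finset.Iic n) → Generation) → ℂ := fun y =>
    z ^ ∑ k : Finset.Iic n, (y k).flatten.length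
  have hWsum : ∀ x : ℕ → Generation, W (Preorder.frestrictLe n x) = z ^ partialSize (n + 1) x := by
    intro x
    simp only [W, partialSize, Preorder.frestrictLe_apply]
    rw [Finset.sum_coe_sort (Finset.Iic n) fun k => (x k).flatten.length]
    congr 2
    ext k
    simp
  have hW : Measurable W := by
    have : Measurable fun y : (i : Finset.Iic n) → Generation =>
        ∑ k : Finset.Iic n, (y k).flatten.length :=
      Finset.measurable_sum _ fun k _ =>
        measurable_length.comp (measurable_flatten.comp (measurable_pi_apply k))
    exact (measurable_from_nat (f := fun k : ℕ => z ^ k)).comp this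
  have hW1 : ∀ y, ‖W y‖ ≤ 1 := fun y => by
    simp only [W, norm_pow]
    exact pow_le_one₀ (norm_nonneg _) hz
  have hΨ : Measurable fun g : Generation => (g.flatten.map f).prod :=
    (measurable_list_map_prod hf).comp measurable_flatten
  have hFm : Measurable fun p : ((i : Finset.Iic n) → Generation) × Generation =>
      W p.1 * (p.2.flatten.map f).prod :=
    (hW.comp measurable_fst).mul (hΨ.comp measurable_snd)
  have hF1 : ∀ p : ((i : Finset.Iic n) → Generation) × Generation,
      ‖W p.1 * (p.2.flatten.map f).prod‖ ≤ 1 := fun p => by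
    rw [norm_mul]
    exact mul_le_one₀ (hW1 _) (norm_nonneg _) (norm_list_map_prod_le_one hf1 _)
  have hlaw := Kernel.map_frestrictLe_trajMeasure_compProd_eq_map_trajMeasure
    (X := fun _ => Generation) (μ₀ := ν.map fun s => [[s]]) (κ := nextGeneration π) (a := n)
  have hpm : IsProbabilityMeasure ((treeLaw π ν).map (Preorder.frestrictLe n)) :=
    Measure.isProbabilityMeasure_map (Preorder.measurable_frestrictLe n).aemeasurable
  calc ∫ x, z ^ partialSize (n + 1) x * ((x (n + 1)).flatten.map f).prod ∂treeLaw π ν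
      = ∫ x, W (Preorder.frestrictLe n x) * ((x (n + 1)).flatten.map f).prod ∂treeLaw π ν := by
        simp_rw [hWsum]
    _ = ∫ p, W p.1 * (p.2.flatten.map f).prod
          ∂(treeLaw π ν).map (fun x => (Preorder.frestrictLe n x, x (n + 1))) := by
        rw [integral_map (by fun_prop) hFm.aestronglyMeasurable]
    _ = ∫ p, W p.1 * (p.2.flatten.map f).prod
          ∂((treeLaw π ν).map (Preorder.frestrictLe n) ⊗ₘ nextGeneration π n) := by
        rw [treeLaw, hlaw]
    _ = ∫ y, ∫ g, W y * (g.flatten.map f).prod ∂nextGeneration π n y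
          ∂(treeLaw π ν).map (Preorder.frestrictLe n) :=
        Measure.integral_compProd
          (Integrable.of_bound hFm.aestronglyMeasurable 1 (ae_of_all _ hF1))
    _ = ∫ y, W y * ((y ⟨n, Finset.mem_Iic.2 le_rfl⟩).flatten.map (offspringFun π f)).prod
          ∂(treeLaw π ν).map (Preorder.frestrictLe n) := by
        congr 1
        funext y
        rw [integral_const_mul]
        congr 1
        have : ∀ g : Generation, (g.flatten.map f).prod =
            (g.map fun l => (l.map f).prod).prod := fun g => by
          rw [List.map_flatten, List.prod_flatten, List.map_map]
          rfl
        simp_rw [this]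
        rw [nextGeneration, Kernel.comap_apply,
          integral_listKernel _ (measurable_list_map_prod hf)]
        simp_rw [integral_offspring π hf hf1]
    _ = ∫ x, W (Preorder.frestrictLe n x) * ((x n).flatten.map (offspringFun π f)).prod
          ∂treeLaw π ν := by
        rw [integral_map (Preorder.measurable_frestrictLe n).aemeasurable]
        · rfl
        · refine (hW.mul ?_).aestronglyMeasurable
          exact (measurable_list_map_prod (measurable_offspringFun π hf hf1)).comp
            (measurable_flatten.comp (measurable_pi_apply _))
    _ = _ := by
        congr 1
        funext x
        rw [hWsum, partialSize, Finset.sum_range_succ, pow_add, mul_assoc, partialSize]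
        congr 1
        induction (x n).flatten with
        | nil => simp
        | cons a l ih =>
          simp only [List.length_cons, List.map_cons, List.prod_cons, ← ih]
          ring

/-- The generating functions of the numbers of vertices in the first `n + 1` generations, as
functions of the age of the root. -/
noncomputable def iterGenFun (z : ℂ) : ℕ → ℝ≥0∞ → ℂ
  | 0 => fun _ => z
  | n + 1 => fun s => z * offspringFun π (iterGenFun z n) s

variable {z : ℂ}

theorem iterGenFun_spec (hz : ‖z‖ ≤ 1) (n : ℕ) :
    Measurable (iterGenFun π z n) ∧ ∀ s, ‖iterGenFun π z n s‖ ≤ 1 := by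
  induction n with
  | zero => exact ⟨measurable_const, fun _ => hz⟩
  | succ n ih =>
    refine ⟨(measurable_offspringFun π ih.1 ih.2).const_mul z, fun s => ?_⟩
    rw [iterGenFun, norm_mul]
    exact mul_le_one₀ hz (norm_nonneg _) (norm_offspringFun_le_one π ih.1 ih.2 s)

theorem integral_pow_partialSize (hz : ‖z‖ ≤ 1) (n : ℕ) :
    ∫ x, z ^ partialSize (n + 1) x ∂treeLaw π ν = ∫ s, iterGenFun π z n s ∂ν := by
  -- Removing a generation raises the index of the iterate by one, so the induction on `m` needs all
  -- `k` at once.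
  have key : ∀ m k : ℕ,
      ∫ x, z ^ partialSize m x * ((x m).flatten.map (iterGenFun π z k)).prod ∂treeLaw π ν =
        ∫ s, iterGenFun π z (k + m) s ∂ν := by
    intro m
    induction m with
    | zero =>
      intro k
      simpa [partialSize] using integral_generation_zero π ν (iterGenFun_spec π hz k).1
    | succ m ih =>
      intro k
      rw [integral_generation_succ π ν hz (iterGenFun_spec π hz k).1 (iterGenFun_spec π hz k).2]
      have := ih (k + 1)
      rw [add_right_comm, add_assoc] at this
      exact this
  rw [← zero_add n, ← key n 0, zero_add]
  congr 1
  funext x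
  rw [partialSize, Finset.sum_range_succ, pow_add, partialSize]
  congr 1
  -- `iterGenFun π z 0` is the constant `z`, so its product over generation `n` is `z` to the size
  -- of that generation.
  simp only [iterGenFun, List.map_const', List.prod_replicate]

end Trees

/-! ### The total size as a limit of partial sizes. -/

section Size

/-- The vertices of the first `n` generations. -/
def verticesBelow (n : ℕ) (x : ℕ → Generation) : Finset (ℕ × ℕ) :=
  ((Finset.range n).sigma fun k => Finset.range (x k).flatten.length).map
    (Equiv.sigmaEquivProd ℕ ℕ).toEmbedding

theorem mem_verticesBelow {n : ℕ} {x : ℕ → Generation} {p : ℕ × ℕ} :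
    p ∈ verticesBelow n x ↔ p.1 < n ∧ p ∈ vertices x := by
  simp only [verticesBelow, Finset.mem_map_equiv, Finset.mem_sigma, Finset.mem_range]
  rfl

theorem card_verticesBelow (n : ℕ) (x : ℕ → Generation) :
    (verticesBelow n x).card = partialSize n x := by
  simp only [verticesBelow, Finset.card_map, Finset.card_sigma, Finset.card_range, partialSize]

theorem eventually_subset_verticesBelow {x : ℕ → Generation} {t : Finset (ℕ × ℕ)}
    (ht : ↑t ⊆ vertices x) : ∀ᶠ n in atTop, t ⊆ verticesBelow n x := by
  obtain ⟨N, hN⟩ := (t.image Prod.fst).exists_nat_subset_range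
  filter_upwards [eventually_ge_atTop N] with n hn p hp
  refine mem_verticesBelow.2 ⟨?_, ht hp⟩
  exact (Finset.mem_range.1 (hN (Finset.mem_image_of_mem _ hp))).trans_le hn

/-- For a finite tree the sequence is eventually constant; for an infinite one the partial sizes are
unbounded and the powers tend to 0, in agreement with `z^∞ = 0`. -/
theorem tendsto_pow_partialSize {z : ℂ} (hz : ‖z‖ < 1) (x : ℕ → Generation) :
    Tendsto (fun n => z ^ partialSize n x) atTop (𝓝 (powENat z (size x))) := by
  by_cases h : (vertices x).Finite
  · have hs : size x = (h.toFinset.card : ℕ∞) := h.encard_eq_coe_toFinset_card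
    have : ∀ᶠ n in atTop, partialSize n x = h.toFinset.card := by
      filter_upwards [eventually_subset_verticesBelow (x := x) (t := h.toFinset) (by simp)]
        with n hn
      rw [← card_verticesBelow]
      congr 1
      refine (hn.antisymm fun p hp => ?_).symm
      simpa using (mem_verticesBelow.1 hp).2
    rw [powENat, hs, if_neg (ENat.natCast_ne_top _), ENat.toNat_natCast]
    exact tendsto_const_nhds.congr' (this.mono fun n hn => by simp only [hn])
  · have hs : size x = ⊤ := Set.encard_eq_top_iff.2 h
    rw [powENat, if_pos hs]
    refine (tendsto_pow_atTop_nhds_zero_of_norm_lt_one hz).comp ?_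
    refine tendsto_atTop.2 fun M => ?_
    obtain ⟨t, ht, hM⟩ := Set.Infinite.exists_subset_card_eq h M
    filter_upwards [eventually_subset_verticesBelow ht] with n hn
    rw [← card_verticesBelow, ← hM]
    exact Finset.card_le_card hn

theorem measurable_powENat_size {z : ℂ} (hz : ‖z‖ < 1) :
    Measurable fun x => powENat z (size x) :=
  measurable_of_tendsto_metrizable
    (fun n => (measurable_from_nat (f := fun k => z ^ k)).comp (measurable_partialSize n))
    (tendsto_pi_nhds.2 fun x => tendsto_pow_partialSize hz x)

theorem norm_powENat_le_one {z : ℂ} (hz : ‖z‖ ≤ 1) (k : ℕ∞) : ‖powENat z k‖ ≤ 1 := by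
  unfold powENat
  split_ifs
  · simp
  · rw [norm_pow]
    exact pow_le_one₀ (norm_nonneg _) hz

theorem tendsto_powENat_one (k : ℕ∞) :
    Tendsto (fun z => powENat z k) (𝓝[Metric.ball 0 1] 1)
      (𝓝 (if k = ⊤ then 0 else 1 : ℝ)) := by
  unfold powENat
  split_ifs with h
  · simpa using tendsto_const_nhds
  · refine Tendsto.mono_left ?_ nhdsWithin_le_nhds
    simpa using (continuous_pow k.toNat).tendsto (1 : ℂ)

instance : NeBot (𝓝[Metric.ball (0 : ℂ) 1] 1) := by
  rw [← mem_closure_iff_nhdsWithin_neBot, closure_ball _ one_ne_zero]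
  simp

end Size

/-! ### The functional equation, and its boundary value at `z = 1`. -/

section GenFun

variable (π : Measure ℝ≥0) [IsProbabilityMeasure π] [HasFiniteMean π]

theorem norm_genFun_le_one (P : Measure (ℕ → Generation)) [IsProbabilityMeasure P] {z : ℂ}
    (hz : ‖z‖ ≤ 1) : ‖genFun P z‖ ≤ 1 := by
  refine (norm_integral_le_of_norm_le_const (C := 1)
    (ae_of_all _ fun x => norm_powENat_le_one hz _)).trans ?_
  simp

instance (s : ℝ≥0∞) : IsProbabilityMeasure (treeLawFrom π s) := by
  unfold treeLawFrom
  infer_instance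

variable {z : ℂ}

theorem tendsto_integral_iterGenFun (hz : ‖z‖ < 1) (ν : Measure ℝ≥0∞) [IsProbabilityMeasure ν] :
    Tendsto (fun n => ∫ s, iterGenFun π z n s ∂ν) atTop (𝓝 (genFun (treeLaw π ν) z)) := by
  simp_rw [← integral_pow_partialSize π ν hz.le]
  refine tendsto_integral_of_dominated_convergence (fun _ => 1) (fun n => ?_)
    (integrable_const _) (fun n => ae_of_all _ fun x => ?_)
    (ae_of_all _ fun x => (tendsto_add_atTop_iff_nat 1).2 (tendsto_pow_partialSize hz x))
  · exact ((measurable_from_nat (f := fun k => z ^ k)).comp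
      (measurable_partialSize (n + 1))).aestronglyMeasurable
  · rw [norm_pow]
    exact pow_le_one₀ (norm_nonneg _) hz.le

theorem tendsto_iterGenFun (hz : ‖z‖ < 1) (s : ℝ≥0∞) :
    Tendsto (fun n => iterGenFun π z n s) atTop (𝓝 (genFun (treeLawFrom π s) z)) := by
  have := tendsto_integral_iterGenFun π hz (Measure.dirac s)
  simp only [integral_dirac] at this
  exact this

theorem measurable_genFun (hz : ‖z‖ < 1) :
    Measurable fun s => genFun (treeLawFrom π s) z :=
  measurable_of_tendsto_metrizable (fun n => (iterGenFun_spec π hz.le n).1)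
    (tendsto_pi_nhds.2 fun s => tendsto_iterGenFun π hz s)

theorem genFun_treeLaw (hz : ‖z‖ < 1) (ν : Measure ℝ≥0∞) [IsProbabilityMeasure ν] :
    genFun (treeLaw π ν) z = ∫ s, genFun (treeLawFrom π s) z ∂ν := by
  refine tendsto_nhds_unique (tendsto_integral_iterGenFun π hz ν) ?_
  exact tendsto_integral_of_dominated_convergence (fun _ => 1)
    (fun n => (iterGenFun_spec π hz.le n).1.aestronglyMeasurable) (integrable_const _)
    (fun n => ae_of_all _ (iterGenFun_spec π hz.le n).2)
    (ae_of_all _ fun s => tendsto_iterGenFun π hz s)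

theorem genFun_treeLawStat (hz : ‖z‖ < 1) :
    genFun (treeLawStat π) z = ∫ u : ℝ≥0, genFun (treeLawFrom π u) z ∂π := by
  have : IsProbabilityMeasure (π.map fun u : ℝ≥0 => (u : ℝ≥0∞)) :=
    Measure.isProbabilityMeasure_map measurable_coe_nnreal_ennreal.aemeasurable
  rw [treeLawStat, genFun_treeLaw π hz,
    integral_map measurable_coe_nnreal_ennreal.aemeasurable
      (measurable_genFun π hz).aestronglyMeasurable]

/-- Continuity of `L_π` under bounded pointwise convergence. -/
theorem tendsto_ageOp {E ι : Type*} [NormedAddCommGroup E] [NormedSpace ℝ E] (π : Measure ℝ≥0)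
    [HasFiniteMean π] {l : Filter ι} [l.IsCountablyGenerated] {f : ι → ℝ≥0 → E} {g : ℝ≥0 → E}
    {C : ℝ} (hf : ∀ᶠ i in l, AEStronglyMeasurable (f i) π) (hC : ∀ᶠ i in l, ∀ u, ‖f i u‖ ≤ C)
    (h : ∀ u, Tendsto (fun i => f i u) l (𝓝 (g u))) (s : ℝ≥0∞) :
    Tendsto (fun i => ageOp π (f i) s) l (𝓝 (ageOp π g s)) := by
  refine tendsto_integral_filter_of_dominated_convergence (fun u : ℝ≥0 => C * u) ?_ ?_
    ((integrable_coe π).const_mul C) (ae_of_all _ fun u => (h u).const_smul _)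
  · filter_upwards [hf] with i hi
    exact (measurable_toReal_min.comp measurable_prodMk_left).aestronglyMeasurable.smul hi
  · filter_upwards [hC] with i hi
    exact ae_of_all _ (norm_smul_min_le hi s)

theorem norm_sub_one_le_two {w : ℂ} (hw : ‖w‖ ≤ 1) : ‖w - 1‖ ≤ 2 :=
  (norm_sub_le _ _).trans (by rw [norm_one]; linarith)

/-- The functional equation of the generating functions. -/
theorem genFun_eq (hz : ‖z‖ < 1) (s : ℝ≥0∞) :
    genFun (treeLawFrom π s) z =
      z * Complex.exp (ageOp π (fun u => genFun (treeLawFrom π u) z - 1) s) := by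
  refine tendsto_nhds_unique ((tendsto_add_atTop_iff_nat 1).2 (tendsto_iterGenFun π hz s)) ?_
  refine ((Complex.continuous_exp.tendsto _).comp (tendsto_ageOp π (C := 2)
    (.of_forall fun n => ?_) (.of_forall fun n u => ?_) (fun u => ?_) s)).const_mul z
  · exact (((iterGenFun_spec π hz.le n).1.comp measurable_coe_nnreal_ennreal).sub_const
      1).aestronglyMeasurable
  · exact norm_sub_one_le_two ((iterGenFun_spec π hz.le n).2 u)
  · exact (tendsto_iterGenFun π hz u).sub_const 1

/-- The probability that the tree with root of age `s` is finite. -/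
noncomputable def finiteProb (s : ℝ≥0∞) : ℝ :=
  ∫ x, (if size x = ⊤ then 0 else 1 : ℝ) ∂treeLawFrom π s

theorem eventually_norm_lt_one : ∀ᶠ z in 𝓝[Metric.ball (0 : ℂ) 1] 1, ‖z‖ < 1 := by
  filter_upwards [self_mem_nhdsWithin] with z hz
  simpa using hz

theorem tendsto_genFun_one (s : ℝ≥0∞) :
    Tendsto (fun z => genFun (treeLawFrom π s) z) (𝓝[Metric.ball 0 1] 1)
      (𝓝 (finiteProb π s : ℂ)) := by
  rw [finiteProb, ← integral_complex_ofReal]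
  refine tendsto_integral_filter_of_dominated_convergence (fun _ => 1) ?_ ?_
    (integrable_const _) (ae_of_all _ fun x => tendsto_powENat_one _)
  · filter_upwards [eventually_norm_lt_one] with z hz
    exact (measurable_powENat_size hz).aestronglyMeasurable
  · filter_upwards [eventually_norm_lt_one] with z hz
    exact ae_of_all _ fun x => norm_powENat_le_one hz.le _

theorem finiteProb_nonneg (s : ℝ≥0∞) : 0 ≤ finiteProb π s :=
  integral_nonneg fun x => by positivity

theorem norm_ofReal_finiteProb_le_one (s : ℝ≥0∞) : ‖(finiteProb π s : ℂ)‖ ≤ 1 :=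
  le_of_tendsto (tendsto_genFun_one π s).norm
    (eventually_norm_lt_one.mono fun _ hz => norm_genFun_le_one _ hz.le)

theorem finiteProb_le_one (s : ℝ≥0∞) : finiteProb π s ≤ 1 := by
  have := norm_ofReal_finiteProb_le_one π s
  rw [Complex.norm_real] at this
  exact (le_abs_self _).trans this

/-- Boundary value of `genFun_eq` as `z → 1` inside the disc, by bounded convergence. It is put in
real form because the extinction argument uses order. -/
theorem finiteProb_eq (s : ℝ≥0∞) :
    finiteProb π s = Real.exp (-ageOp π (fun u => 1 - finiteProb π u) s) := by
  have h : (finiteProb π s : ℂ) =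
      1 * Complex.exp (ageOp π (fun u => (finiteProb π u : ℂ) - 1) s) := by
    refine tendsto_nhds_unique (tendsto_genFun_one π s) ?_
    have h2 : Tendsto
        (fun z => z * Complex.exp (ageOp π (fun u => genFun (treeLawFrom π u) z - 1) s))
        (𝓝[Metric.ball 0 1] 1)
        (𝓝 (1 * Complex.exp (ageOp π (fun u => (finiteProb π u : ℂ) - 1) s))) := by
      refine (tendsto_id.mono_left nhdsWithin_le_nhds).mul ((Complex.continuous_exp.tendsto _).comp
        (tendsto_ageOp π (C := 2) ?_ ?_ (fun u => (tendsto_genFun_one π u).sub_const 1) s))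
      · filter_upwards [eventually_norm_lt_one] with z hz
        exact (((measurable_genFun π hz).comp measurable_coe_nnreal_ennreal).sub_const
          1).aestronglyMeasurable
      · filter_upwards [eventually_norm_lt_one] with z hz u
        exact norm_sub_one_le_two (norm_genFun_le_one _ hz.le)
    refine h2.congr' ?_
    filter_upwards [eventually_norm_lt_one] with z hz
    exact (genFun_eq π hz s).symm
  have h3 : ageOp π (fun u => (finiteProb π u : ℂ) - 1) s =
      ((-ageOp π (fun u => 1 - finiteProb π u) s : ℝ) : ℂ) := by
    rw [ageOp, ageOp, ← integral_neg, ← integral_complex_ofReal]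
    congr 1
    funext u
    simp only [smul_eq_mul, Complex.real_smul]
    push_cast
    ring
  rw [one_mul, h3, ← Complex.ofReal_exp] at h
  exact_mod_cast h

theorem measurable_finiteProb : Measurable (finiteProb π) := by
  -- Measurability passes to limits of sequences, so the limit along the filter is taken along one
  -- sequence, shifted by `N` to stay in the disc.
  obtain ⟨x, hx⟩ := exists_seq_tendsto (𝓝[Metric.ball (0 : ℂ) 1] 1)
  obtain ⟨N, hN⟩ := (hx.eventually eventually_norm_lt_one).exists_forall_of_atTop
  have : Measurable fun s => (finiteProb π s : ℂ) :=
    measurable_of_tendsto_metrizable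
      (f := fun n s => genFun (treeLawFrom π s) (x (n + N)))
      (fun n => measurable_genFun π (hN _ (Nat.le_add_left _ _)))
      (tendsto_pi_nhds.2 fun s =>
        ((tendsto_genFun_one π s).comp hx).comp (tendsto_add_atTop_nat N))
  exact Complex.measurable_re.comp this

end GenFun

/-! ### Algebra, positivity and symmetry of `L_π`. -/

section Basic

variable {E : Type*} [NormedAddCommGroup E] [NormedSpace ℝ E] {π : Measure ℝ≥0}

theorem ageOp_congr_ae {f g : ℝ≥0 → E} (h : f =ᵐ[π] g) : ageOp π f = ageOp π g := by
  funext s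
  refine integral_congr_ae ?_
  filter_upwards [h] with u hu
  rw [hu]

theorem ageOp_zero_right (f : ℝ≥0 → E) : ageOp π f 0 = 0 := by
  simp [ageOp]

theorem branchingOp_eq (f : ℝ≥0 → ℝ) (s : ℝ≥0) : branchingOp π f s = ageOp π f s := by
  unfold branchingOp ageOp
  congr 1
  funext u
  rw [← ENNReal.coe_min, ENNReal.coe_toReal, smul_eq_mul, mul_comm]

theorem ageOp_const_mul {𝕜 : Type*} [RCLike 𝕜] (c : 𝕜) (f : ℝ≥0 → 𝕜) (s : ℝ≥0∞) :
    ageOp π (fun u => c * f u) s = c * ageOp π f s := by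
  unfold ageOp
  rw [← integral_const_mul]
  congr 1
  funext u
  rw [mul_smul_comm]

theorem ageOp_ofReal (f : ℝ≥0 → ℝ) (s : ℝ≥0∞) :
    ageOp π (fun u => (f u : ℂ)) s = (ageOp π f s : ℝ) := by
  unfold ageOp
  rw [← integral_complex_ofReal]
  congr 1
  funext u
  simp

theorem ageOp_nonneg {f : ℝ≥0 → ℝ} (hf : ∀ u, 0 ≤ f u) (s : ℝ≥0∞) : 0 ≤ ageOp π f s :=
  integral_nonneg fun u => smul_nonneg ENNReal.toReal_nonneg (hf u)

theorem norm_ageOp_le (f : ℝ≥0 → E) (s : ℝ≥0∞) :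
    ‖ageOp π f s‖ ≤ ageOp π (fun u => ‖f u‖) s := by
  refine (norm_integral_le_integral_norm _).trans_eq ?_
  unfold ageOp
  congr 1
  funext u
  rw [norm_smul, Real.norm_of_nonneg ENNReal.toReal_nonneg, smul_eq_mul]

theorem ageOp_sub {f g : ℝ≥0 → E} {s : ℝ≥0∞}
    (hf : Integrable (fun u : ℝ≥0 => (min s (u : ℝ≥0∞)).toReal • f u) π)
    (hg : Integrable (fun u : ℝ≥0 => (min s (u : ℝ≥0∞)).toReal • g u) π) :
    ageOp π (fun u => f u - g u) s = ageOp π f s - ageOp π g s := by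
  unfold ageOp
  rw [← integral_sub hf hg]
  simp_rw [smul_sub]

theorem ageOp_add {f g : ℝ≥0 → E} {s : ℝ≥0∞}
    (hf : Integrable (fun u : ℝ≥0 => (min s (u : ℝ≥0∞)).toReal • f u) π)
    (hg : Integrable (fun u : ℝ≥0 => (min s (u : ℝ≥0∞)).toReal • g u) π) :
    ageOp π (fun u => f u + g u) s = ageOp π f s + ageOp π g s := by
  unfold ageOp
  rw [← integral_add hf hg]
  simp_rw [smul_add]

/-- Integrability of the integrand of `L_π f s` for finite `s`. -/
theorem integrable_smul_min_of_integrable {f : ℝ≥0 → E} (hf : Integrable f π) (s : ℝ≥0) :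
    Integrable (fun u : ℝ≥0 => (min (s : ℝ≥0∞) (u : ℝ≥0∞)).toReal • f u) π := by
  refine (hf.norm.const_mul (s : ℝ)).mono'
    ((measurable_toReal_min.comp measurable_prodMk_left).aestronglyMeasurable.smul hf.1)
    (ae_of_all _ fun u => ?_)
  rw [norm_smul, Real.norm_of_nonneg ENNReal.toReal_nonneg]
  gcongr
  exact ENNReal.toReal_le_of_le_ofReal s.2 (by simp)

/-- A vanishing integral of a nonnegative function against the kernel at some `s > 0` forces the
function to vanish away from `0`. -/
theorem ae_eq_zero_of_ageOp_eq_zero {f : ℝ≥0 → ℝ} (hf : ∀ u, 0 ≤ f u) (h0 : f 0 = 0) {s : ℝ≥0∞}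
    (hs : 0 < s) (hi : Integrable (fun u : ℝ≥0 => (min s (u : ℝ≥0∞)).toReal • f u) π)
    (h : ageOp π f s = 0) : f =ᵐ[π] 0 := by
  have := (integral_eq_zero_iff_of_nonneg
    (fun u => smul_nonneg ENNReal.toReal_nonneg (hf u)) hi).1 h
  filter_upwards [this] with u hu
  simp only [Pi.zero_apply, smul_eq_mul, mul_eq_zero, ENNReal.toReal_eq_zero_iff] at hu ⊢
  -- The kernel `s ∧ u` vanishes for `s > 0` only at `u = 0`, where `h0` takes over.
  rcases hu with (hu | hu) | hu
  · rcases min_choice s (u : ℝ≥0∞) with h1 | h1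
    · exact absurd (h1.symm.trans hu) hs.ne'
    · rw [hu] at h1
      have : u = 0 := by simpa using h1.symm
      rw [this, h0]
  · simp at hu
  · exact hu

/-- `L_π` is symmetric. -/
theorem integral_ageOp_mul {𝕜 : Type*} [RCLike 𝕜] [IsFiniteMeasure π] [HasFiniteMean π]
    {f g : ℝ≥0 → 𝕜} {C D : ℝ}
    (hf : AEStronglyMeasurable f π) (hC : ∀ u, ‖f u‖ ≤ C)
    (hg : AEStronglyMeasurable g π) (hD : ∀ u, ‖g u‖ ≤ D) :
    ∫ s : ℝ≥0, ageOp π f s * g s ∂π = ∫ s : ℝ≥0, f s * ageOp π g s ∂π := by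
  have hint : Integrable (Function.uncurry fun (s u : ℝ≥0) =>
      ((min (s : ℝ≥0∞) (u : ℝ≥0∞)).toReal • f u) * g s) (π.prod π) := by
    have hb : Integrable (fun p : ℝ≥0 × ℝ≥0 => C * D * (p.2 : ℝ)) (π.prod π) :=
      ((integrable_coe π).comp_snd π).const_mul _
    refine hb.mono' ?_ (ae_of_all _ fun p => ?_)
    · refine (AEStronglyMeasurable.smul ?_ hf.comp_snd).mul hg.comp_fst
      exact (measurable_toReal_min.comp ((measurable_coe_nnreal_ennreal.comp
        measurable_fst).prodMk measurable_snd)).aestronglyMeasurable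
    · simp only [Function.uncurry]
      rw [norm_mul]
      calc _ ≤ (C * p.2) * D := mul_le_mul (norm_smul_min_le hC _ _) (hD _) (norm_nonneg _)
            (mul_nonneg ((norm_nonneg _).trans (hC 0)) p.2.2)
        _ = C * D * p.2 := by ring
  calc ∫ s : ℝ≥0, ageOp π f s * g s ∂π
      = ∫ s : ℝ≥0, ∫ u : ℝ≥0, ((min (s : ℝ≥0∞) (u : ℝ≥0∞)).toReal • f u) * g s ∂π ∂π := by
        simp_rw [ageOp, ← integral_mul_const]
    _ = ∫ u : ℝ≥0, ∫ s : ℝ≥0, ((min (s : ℝ≥0∞) (u : ℝ≥0∞)).toReal • f u) * g s ∂π ∂π :=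
        integral_integral_swap hint
    _ = _ := by
        simp_rw [ageOp, ← integral_const_mul]
        congr 1
        funext u
        congr 1
        funext s
        rw [min_comm, smul_mul_assoc, mul_smul_comm]

end Basic

/-! ### `L_π` as a compact operator on continuous functions. -/

section Operator

variable (π : Measure ℝ≥0) [HasFiniteMean π]

theorem aestronglyMeasurable_coe (π : Measure ℝ≥0) {E : Type*} [NormedAddCommGroup E]
    {f : ℝ≥0∞ → E} (hf : Continuous f) : AEStronglyMeasurable (fun u : ℝ≥0 => f u) π :=
  (hf.comp ENNReal.continuous_coe).aestronglyMeasurable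

theorem integrable_smul_min_continuousMap (f : C(ℝ≥0∞, ℂ)) (s : ℝ≥0∞) :
    Integrable (fun u : ℝ≥0 => (min s (u : ℝ≥0∞)).toReal • f u) π :=
  integrable_smul_min π (aestronglyMeasurable_coe π f.continuous) (fun u => f.norm_coe_le_norm u) s

/-- `L_π` as a bounded operator on `C([0, ∞], ℂ)`. -/
noncomputable def ageCLM : C(ℝ≥0∞, ℂ) →L[ℂ] C(ℝ≥0∞, ℂ) :=
  LinearMap.mkContinuous
    { toFun := fun f => ⟨ageOp π fun u => f u,
        continuous_ageOp π (aestronglyMeasurable_coe π f.continuous) fun u => f.norm_coe_le_norm u⟩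
      map_add' := fun f g => by
        ext s
        exact ageOp_add (integrable_smul_min_continuousMap π f s)
          (integrable_smul_min_continuousMap π g s)
      map_smul' := fun c f => by
        ext s
        exact ageOp_const_mul c (fun u => f u) s }
    (∫ u, (u : ℝ) ∂π) fun f => by
      have h0 : 0 ≤ ∫ u : ℝ≥0, (u : ℝ) ∂π := integral_nonneg fun u => u.2
      rw [ContinuousMap.norm_le _ (by positivity)]
      intro s
      refine (norm_integral_le_of_norm_le ((integrable_coe π).const_mul ‖f‖)
        (ae_of_all _ (norm_smul_min_le (fun u => f.norm_coe_le_norm u) s))).trans_eq ?_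
      rw [integral_const_mul, mul_comm]

@[simp]
theorem ageCLM_apply (f : C(ℝ≥0∞, ℂ)) (s : ℝ≥0∞) : ageCLM π f s = ageOp π (fun u => f u) s := rfl

/-- Arzelà–Ascoli: on the unit ball, `|L f(s₀) - L f(s)|` is at most `∫ |s₀ ∧ u - s ∧ u| dπ(u)`, a
modulus independent of `f` that is continuous in `s` up to `∞` because `∫ u dπ(u)` is finite. -/
theorem isCompactOperator_ageCLM : IsCompactOperator (ageCLM π) := by
  let M : ℝ := ‖ageCLM π‖
  let e := ContinuousMap.linearIsometryBoundedOfCompact ℝ≥0∞ ℂ ℂ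
  let A : Set (BoundedContinuousFunction ℝ≥0∞ ℂ) :=
    (fun f => e (ageCLM π f)) '' Metric.closedBall 0 1
  have hA : IsCompact (closure A) := by
    refine BoundedContinuousFunction.arzela_ascoli (Metric.closedBall 0 M)
      (isCompact_closedBall 0 M) A ?_ ?_
    · rintro _ s ⟨f, hf, rfl⟩
      have hf' : ‖f‖ ≤ 1 := by simpa using hf
      have : ‖ageCLM π f s‖ ≤ M :=
        ((ageCLM π f).norm_coe_le_norm s).trans
          (((ageCLM π).le_opNorm f).trans (mul_le_of_le_one_right (norm_nonneg _) hf'))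
      simpa [e] using this
    · intro s₀
      let b : ℝ≥0∞ → ℝ := fun s => ∫ u : ℝ≥0,
        |(min s₀ (u : ℝ≥0∞)).toReal - (min s (u : ℝ≥0∞)).toReal| ∂π
      have hbound : ∀ (s : ℝ≥0∞) (u : ℝ≥0),
          |(min s₀ (u : ℝ≥0∞)).toReal - (min s (u : ℝ≥0∞)).toReal| ≤ u := fun s u => by
        have h1 := toReal_min_le s₀ u
        have h2 := toReal_min_le s u
        have h3 : 0 ≤ (min s₀ (u : ℝ≥0∞)).toReal := ENNReal.toReal_nonneg
        have h4 : 0 ≤ (min s (u : ℝ≥0∞)).toReal := ENNReal.toReal_nonneg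
        rw [abs_le]
        constructor <;> linarith
      have hmeas : ∀ s : ℝ≥0∞, AEStronglyMeasurable (fun u : ℝ≥0 =>
          |(min s₀ (u : ℝ≥0∞)).toReal - (min s (u : ℝ≥0∞)).toReal|) π := fun s =>
        (((measurable_toReal_min.comp (measurable_prodMk_left (x := s₀))).sub
          (measurable_toReal_min.comp
            (measurable_prodMk_left (x := s)))).norm).aestronglyMeasurable
      have hb : Continuous b := by
        refine continuous_of_dominated hmeas
          (fun s => ae_of_all _ fun u => ?_) (integrable_coe π) (ae_of_all _ fun u => ?_)
        · rw [Real.norm_eq_abs, abs_abs]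
          exact hbound s u
        · exact (continuous_const.sub (continuous_toReal_min u)).abs
      have hb0 : b s₀ = 0 := by simp [b]
      refine Metric.equicontinuousAt_of_continuity_modulus b (hb0 ▸ hb.tendsto s₀) _
        (.of_forall fun s => ?_)
      rintro ⟨_, f, hf, rfl⟩
      have hf' : ‖f‖ ≤ 1 := by simpa using hf
      change dist (ageOp π (fun u => f u) s₀) (ageOp π (fun u => f u) s) ≤ b s
      rw [dist_eq_norm, ageOp, ageOp, ← integral_sub (integrable_smul_min_continuousMap π f s₀)
        (integrable_smul_min_continuousMap π f s)]
      refine norm_integral_le_of_norm_le ((integrable_coe π).mono' (hmeas s)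
        (ae_of_all _ fun u => ?_)) (ae_of_all _ fun u => ?_)
      · rw [Real.norm_eq_abs, abs_abs]
        exact hbound s u
      · rw [← sub_smul, norm_smul, Real.norm_eq_abs]
        exact mul_le_of_le_one_right (abs_nonneg _) ((f.norm_coe_le_norm _).trans hf')
  refine ⟨e.symm '' closure A, hA.image e.symm.continuous,
    mem_of_superset (Metric.closedBall_mem_nhds 0 one_pos) fun f hf => ?_⟩
  exact ⟨e (ageCLM π f), subset_closure ⟨f, hf, rfl⟩, e.symm_apply_apply _⟩

end Operator

/-! ### Consequences of `‖L_π‖ = 1` on `L²(π)`. -/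

section Critical

variable {π : Measure ℝ≥0} [IsProbabilityMeasure π]

omit [IsProbabilityMeasure π] in
theorem eLpNorm_branchingOp_le (hπ : AgeCritical π) {f : ℝ≥0 → ℝ} (hf : MemLp f 2 π) :
    eLpNorm (branchingOp π f) 2 π ≤ eLpNorm f 2 π := by
  by_cases h0 : eLpNorm f 2 π = 0
  · rw [eLpNorm_eq_zero_iff hf.1 two_ne_zero] at h0
    have : branchingOp π f = fun _ => 0 := by
      funext s
      rw [branchingOp_eq, ageOp_congr_ae h0]
      simp [ageOp]
    simp [this]
  · set N := (eLpNorm f 2 π).toReal with hN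
    have hNpos : 0 < N := ENNReal.toReal_pos h0 hf.eLpNorm_ne_top
    have hNe : eLpNorm f 2 π = ENNReal.ofReal N := (ENNReal.ofReal_toReal hf.eLpNorm_ne_top).symm
    have h1 : eLpNorm (fun u => N⁻¹ * f u) 2 π ≤ 1 := by
      have := eLpNorm_const_smul (N⁻¹) f 2 π
      change eLpNorm (N⁻¹ • f) 2 π ≤ 1
      rw [this, hNe, ← ofReal_norm, Real.norm_of_nonneg (by positivity),
        ← ENNReal.ofReal_mul (by positivity), inv_mul_cancel₀ hNpos.ne', ENNReal.ofReal_one]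
    have h2 : eLpNorm (branchingOp π fun u => N⁻¹ * f u) 2 π ≤ 1 := by
      rw [← show branchingOpNorm π = 1 from hπ]
      exact le_iSup₂_of_le (fun u => N⁻¹ * f u) (hf.const_mul _)
        (le_iSup_of_le h1 le_rfl)
    have h3 : branchingOp π (fun u => N⁻¹ * f u) = N⁻¹ • branchingOp π f := by
      funext s
      rw [branchingOp_eq, ageOp_const_mul, Pi.smul_apply, branchingOp_eq, smul_eq_mul]
    have h4 : branchingOp π f = N • branchingOp π (fun u => N⁻¹ * f u) := by
      rw [h3, smul_smul, mul_inv_cancel₀ hNpos.ne', one_smul]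
    rw [h4, eLpNorm_const_smul, hNe, ← ofReal_norm, Real.norm_of_nonneg hNpos.le]
    exact mul_le_of_le_one_right zero_le h2

theorem measurable_ageOp {f : ℝ≥0 → ℝ} (hf : AEStronglyMeasurable f π) :
    Measurable fun s : ℝ≥0 => ageOp π f s := by
  have : (fun s : ℝ≥0 => ageOp π f s) = fun s : ℝ≥0 => ageOp π (hf.mk f) s := by
    rw [ageOp_congr_ae hf.ae_eq_mk]
  rw [this]
  refine (StronglyMeasurable.integral_prod_right
    (f := fun (s u : ℝ≥0) => (min (s : ℝ≥0∞) (u : ℝ≥0∞)).toReal • hf.mk f u) ?_).measurable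
  refine Measurable.stronglyMeasurable ?_
  exact (measurable_toReal_min.comp ((measurable_coe_nnreal_ennreal.comp
    measurable_fst).prodMk measurable_snd)).smul (hf.stronglyMeasurable_mk.measurable.comp
      measurable_snd)

theorem memLp_ageOp (hπ : AgeCritical π) {f : ℝ≥0 → ℝ} (hf : MemLp f 2 π) :
    MemLp (fun s : ℝ≥0 => ageOp π f s) 2 π := by
  refine ⟨(measurable_ageOp hf.1).aestronglyMeasurable, ?_⟩
  have : (fun s : ℝ≥0 => ageOp π f s) = branchingOp π f := funext fun s => (branchingOp_eq f s).symm
  rw [this]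
  exact (eLpNorm_branchingOp_le hπ hf).trans_lt hf.2

omit [IsProbabilityMeasure π] in
theorem eLpNorm_two_eq {f : ℝ≥0 → ℝ} (hf : MemLp f 2 π) :
    eLpNorm f 2 π = ENNReal.ofReal (√(∫ u, f u ^ 2 ∂π)) := by
  rw [hf.eLpNorm_eq_integral_rpow_norm two_ne_zero ENNReal.ofNat_ne_top, Real.sqrt_eq_rpow]
  simp

theorem integral_sq_ageOp_le (hπ : AgeCritical π) {f : ℝ≥0 → ℝ} (hf : MemLp f 2 π) :
    ∫ s : ℝ≥0, ageOp π f s ^ 2 ∂π ≤ ∫ s, f s ^ 2 ∂π := by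
  have h := eLpNorm_branchingOp_le hπ hf
  have h2 : (fun s : ℝ≥0 => ageOp π f s) = branchingOp π f :=
    funext fun s => (branchingOp_eq f s).symm
  rw [← h2, eLpNorm_two_eq (memLp_ageOp hπ hf), eLpNorm_two_eq hf,
    ENNReal.ofReal_le_ofReal_iff (Real.sqrt_nonneg _)] at h
  exact (Real.sqrt_le_sqrt_iff (integral_nonneg fun _ => sq_nonneg _)).1 h

/-- In the critical case, a nonnegative subsolution of `f ≤ L_π f` is a solution. -/
theorem ageOp_ae_eq_of_le (hπ : AgeCritical π) {f : ℝ≥0 → ℝ} (hf : MemLp f 2 π)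
    (h0 : ∀ u, 0 ≤ f u) (hle : ∀ u : ℝ≥0, f u ≤ ageOp π f u) :
    (fun u : ℝ≥0 => ageOp π f u) =ᵐ[π] f := by
  have hL := memLp_ageOp hπ hf
  -- The squares can only increase pointwise, while their integral cannot increase.
  have hsq : ∀ u : ℝ≥0, 0 ≤ ageOp π f u ^ 2 - f u ^ 2 := fun u =>
    sub_nonneg.2 (pow_le_pow_left₀ (h0 u) (hle u) 2)
  have hint : Integrable (fun u : ℝ≥0 => ageOp π f u ^ 2 - f u ^ 2) π :=
    hL.integrable_sq.sub hf.integrable_sq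
  have hz : ∫ u : ℝ≥0, (ageOp π f u ^ 2 - f u ^ 2) ∂π = 0 := by
    refine le_antisymm ?_ (integral_nonneg hsq)
    rw [integral_sub hL.integrable_sq hf.integrable_sq]
    linarith [integral_sq_ageOp_le hπ hf]
  filter_upwards [(integral_eq_zero_iff_of_nonneg hsq hint).1 hz] with u hu
  have hu' : ageOp π f u ^ 2 = f u ^ 2 := by
    simpa [sub_eq_zero] using hu
  exact (pow_left_inj₀ ((h0 u).trans (hle u)) (h0 u) two_ne_zero).1 hu'

end Critical

/-! ### From the `L²` norm to an eigenvector in the space of continuous functions. -/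

section SpectralRadius

theorem exists_norm_pow_le_of_spectralRadius_lt_one {A : Type*} [NormedRing A] [NormedAlgebra ℂ A]
    [CompleteSpace A] {a : A} (h : spectralRadius ℂ a < 1) :
    ∃ ρ : ℝ, 0 < ρ ∧ ρ < 1 ∧ ∀ᶠ n : ℕ in atTop, ‖a ^ n‖ ≤ ρ ^ n := by
  obtain ⟨ρ, h1, h2⟩ := ENNReal.lt_iff_exists_nnreal_btwn.1 h
  have hρ : 0 < ρ := by exact_mod_cast zero_le.trans_lt h1
  refine ⟨ρ, by exact_mod_cast hρ, by exact_mod_cast h2, ?_⟩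
  filter_upwards [(spectrum.pow_nnnorm_pow_one_div_tendsto_nhds_spectralRadius a).eventually_lt_const
    h1, eventually_gt_atTop 0] with n hn hn0
  have hn0' : (n : ℝ) ≠ 0 := by exact_mod_cast hn0.ne'
  have := pow_le_pow_left' hn.le n
  rw [← ENNReal.rpow_natCast, ← ENNReal.rpow_mul, one_div_mul_cancel hn0',
    ENNReal.rpow_one] at this
  exact_mod_cast this

/-- The spectral radius is attained at a spectral value. If it is less than 1, Gelfand's formula
gives the decay; otherwise that value is nonzero and, by compactness, an eigenvalue. -/
theorem _root_.IsCompactOperator.norm_pow_le_or_exists_eigenvector {X : Type*}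
    [NormedAddCommGroup X] [NormedSpace ℂ X] [CompleteSpace X] [Nontrivial X] {T : X →L[ℂ] X}
    (hT : IsCompactOperator T) :
    (∃ ρ : ℝ, 0 < ρ ∧ ρ < 1 ∧ ∀ᶠ n : ℕ in atTop, ‖T ^ n‖ ≤ ρ ^ n) ∨
      ∃ (c : ℂ) (y : X), 1 ≤ ‖c‖ ∧ y ≠ 0 ∧ T y = c • y := by
  by_cases h : spectralRadius ℂ T < 1
  · exact .inl (exists_norm_pow_le_of_spectralRadius_lt_one h)
  · right
    obtain ⟨c, hc, hcr⟩ := spectrum.exists_nnnorm_eq_spectralRadius T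
    have hc1 : 1 ≤ ‖c‖ := by
      rw [← hcr, not_lt] at h
      exact_mod_cast h
    have hc0 : c ≠ 0 := by
      rintro rfl
      norm_num at hc1
    obtain ⟨y, hy⟩ := ((hT.hasEigenvalue_iff_mem_spectrum hc0).2 hc).exists_hasEigenvector
    exact ⟨c, y, hc1, hy.2, hy.apply_eq_smul⟩

/-- A log-convex sequence that decays geometrically at some rate decays at that rate from the
start. -/
theorem le_mul_of_logConvex {A : ℕ → ℝ} {ρ M κ : ℝ} (hρ : 0 < ρ) (hκ : ρ ^ 2 < κ)
    (hpos : 0 ≤ A 0) (hconv : ∀ n, 0 ≤ A (n + 2) - 2 * κ * A (n + 1) + κ ^ 2 * A n)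
    (hdecay : ∀ᶠ n in atTop, A (n + 1) ≤ (ρ ^ n) ^ 2 * M) : A 1 ≤ κ * A 0 := by
  by_contra! hlt
  have hκ0 : 0 < κ := (by positivity : 0 < ρ ^ 2).trans hκ
  -- Once `A` grows by a factor `κ`, convexity keeps it growing: `A (n + 2) ≥ 2κ A (n + 1) - κ² A n
  -- ≥ κ A (n + 1)`. This contradicts decay at the smaller rate `ρ²`.
  have hstep : ∀ n, κ * A n ≤ A (n + 1) := by
    intro n
    induction n with
    | zero => exact hlt.le
    | succ n ih => nlinarith [hconv n]
  have hgeo : ∀ n, κ ^ n * A 1 ≤ A (n + 1) := by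
    intro n
    induction n with
    | zero => simp
    | succ n ih =>
      calc κ ^ (n + 1) * A 1 = κ * (κ ^ n * A 1) := by ring
        _ ≤ κ * A (n + 1) := by gcongr
        _ ≤ A (n + 1 + 1) := hstep _
  have hA1 : 0 < A 1 := (by positivity : 0 ≤ κ * A 0).trans_lt hlt
  have htend : Tendsto (fun n : ℕ => (ρ ^ 2 / κ) ^ n * M) atTop (𝓝 (0 * M)) :=
    (tendsto_pow_atTop_nhds_zero_of_lt_one (by positivity) ((div_lt_one hκ0).2 hκ)).mul_const M
  rw [zero_mul] at htend
  refine absurd (ge_of_tendsto htend (b := A 1) ?_) (not_le.2 hA1)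
  filter_upwards [hdecay] with n hn
  have := (hgeo n).trans hn
  rw [div_pow, div_mul_eq_mul_div, le_div_iff₀ (by positivity), ← pow_mul, mul_comm 2 n, pow_mul]
  linarith

variable {π : Measure ℝ≥0} [IsProbabilityMeasure π] [HasFiniteMean π]

/-- Sup norm decay of `Lⁿ` controls `‖Lⁿ f‖²` in `L²` only for large `n`; symmetry of `L` makes this
sequence log-convex, and `le_mul_of_logConvex` brings the rate down to the first step. -/
theorem integral_sq_ageOp_le_of_norm_pow_le {ρ κ : ℝ} (hρ : 0 < ρ) (hκ : ρ ^ 2 < κ)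
    (hT : ∀ᶠ n : ℕ in atTop, ‖ageCLM π ^ n‖ ≤ ρ ^ n) {f : ℝ≥0 → ℝ} {N : ℝ}
    (hf : AEStronglyMeasurable f π) (hN : ∀ u, ‖f u‖ ≤ N) :
    ∫ s : ℝ≥0, ageOp π f s ^ 2 ∂π ≤ κ * ∫ s, f s ^ 2 ∂π := by
  let u : ℕ → ℝ≥0 → ℝ := fun n => (fun g : ℝ≥0 → ℝ => fun s : ℝ≥0 => ageOp π g s)^[n] f
  have hu : ∀ n, u (n + 1) = fun s : ℝ≥0 => ageOp π (u n) s := fun n =>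
    Function.iterate_succ_apply' _ _ _
  -- `f` need not be continuous but `L f` is, so the powers of the operator act on `L f`. This
  -- shifts the index by one.
  let g : C(ℝ≥0∞, ℂ) := ⟨fun s => ((ageOp π f s : ℝ) : ℂ),
    Complex.continuous_ofReal.comp (continuous_ageOp π hf hN)⟩
  have hg : ∀ n (s : ℝ≥0), (u (n + 1) s : ℂ) = (ageCLM π ^ n) g s := by
    intro n
    induction n with
    | zero => exact fun s => rfl
    | succ n ih =>
      intro s
      rw [hu, ← ageOp_ofReal, pow_succ', mul_apply_eq_comp, ageCLM_apply]
      simp_rw [ih]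
  have hbound : ∀ n (s : ℝ≥0), ‖u (n + 1) s‖ ≤ ‖(ageCLM π ^ n) g‖ := fun n s => by
    rw [← Complex.norm_real, hg]
    exact ContinuousMap.norm_coe_le_norm _ _
  have hspec : ∀ n, AEStronglyMeasurable (u n) π ∧ ∃ C, ∀ s, ‖u n s‖ ≤ C := by
    intro n
    induction n with
    | zero => exact ⟨hf, N, hN⟩
    | succ n ih =>
      refine ⟨?_, _, hbound n⟩
      rw [hu]
      exact (measurable_ageOp ih.1).aestronglyMeasurable
  have hmem : ∀ n, MemLp (u n) 2 π := fun n => by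
    obtain ⟨h1, C, hC⟩ := hspec n
    exact MemLp.of_bound h1 C (ae_of_all _ hC)
  have hsymm : ∀ n, ∫ s, u (n + 2) s * u n s ∂π = ∫ s, u (n + 1) s ^ 2 ∂π := by
    intro n
    obtain ⟨h1, C, hC⟩ := hspec (n + 1)
    obtain ⟨h2, D, hD⟩ := hspec n
    have := integral_ageOp_mul (π := π) h1 hC h2 hD
    rw [hu (n + 1), this]
    congr 1
    funext s
    rw [hu n, sq]
  refine le_mul_of_logConvex (A := fun n => ∫ s, u n s ^ 2 ∂π) (M := ‖g‖ ^ 2) hρ hκ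
    (integral_nonneg fun s => sq_nonneg _) (fun n => ?_) ?_
  · have h1 : Integrable (fun s => u (n + 2) s * u n s) π := (hmem (n + 2)).integrable_mul (hmem n)
    -- Expanding this square and replacing the cross term by `hsymm` is the convexity inequality.
    have h2 : 0 ≤ ∫ s, (u (n + 2) s - κ * u n s) ^ 2 ∂π := integral_nonneg fun s => sq_nonneg _
    have h3 : ∫ s, (u (n + 2) s - κ * u n s) ^ 2 ∂π =
        ∫ s, u (n + 2) s ^ 2 ∂π - 2 * κ * ∫ s, u (n + 2) s * u n s ∂π +
          κ ^ 2 * ∫ s, u n s ^ 2 ∂π := by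
      have he : (fun s => (u (n + 2) s - κ * u n s) ^ 2) = fun s =>
          (u (n + 2) s ^ 2 - 2 * κ * (u (n + 2) s * u n s)) + κ ^ 2 * u n s ^ 2 := by
        funext s
        ring
      have hA : Integrable (fun s => u (n + 2) s ^ 2 - 2 * κ * (u (n + 2) s * u n s)) π :=
        (hmem _).integrable_sq.sub (h1.const_mul _)
      rw [he, integral_add hA ((hmem _).integrable_sq.const_mul _),
        integral_sub (hmem _).integrable_sq (h1.const_mul _), integral_const_mul,
        integral_const_mul]
    rw [h3, hsymm] at h2
    exact h2
  · filter_upwards [hT] with n hn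
    have hb : ∀ s, u (n + 1) s ^ 2 ≤ (ρ ^ n) ^ 2 * ‖g‖ ^ 2 := fun s => by
      rw [← mul_pow, ← sq_abs]
      refine pow_le_pow_left₀ (abs_nonneg _) ?_ 2
      refine (hbound n s).trans (((ageCLM π ^ n).le_opNorm g).trans ?_)
      gcongr
    calc ∫ s, u (n + 1) s ^ 2 ∂π ≤ ∫ _, (ρ ^ n) ^ 2 * ‖g‖ ^ 2 ∂π :=
          integral_mono (hmem _).integrable_sq (integrable_const _) hb
      _ = _ := by simp

theorem branchingOpNorm_lt_one_of_norm_pow_le {ρ : ℝ} (hρ : 0 < ρ) (hρ1 : ρ < 1)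
    (hT : ∀ᶠ n : ℕ in atTop, ‖ageCLM π ^ n‖ ≤ ρ ^ n) : branchingOpNorm π < 1 := by
  -- The choice `κ = ρ` lies strictly between `ρ²` and 1.
  have hκ : ρ ^ 2 < ρ := by nlinarith
  have hle : branchingOpNorm π ≤ ENNReal.ofReal (√ρ) := by
    refine iSup₂_le fun f hf => iSup_le fun hf1 => ?_
    have h2 : branchingOp π f = fun s : ℝ≥0 => ageOp π f s :=
      funext fun s => branchingOp_eq f s
    rw [h2]
    obtain ⟨F, hF, hFf⟩ := hf.1
    have hcongr : ageOp π f = ageOp π F := ageOp_congr_ae hFf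
    have hFm : MemLp F 2 π := (memLp_congr_ae hFf).1 hf
    have hF1 : eLpNorm F 2 π ≤ 1 := by rwa [← eLpNorm_congr_ae hFf]
    rw [hcongr]
    -- The bound is known for bounded functions; truncation and Fatou's lemma for the `L²` norm
    -- extend it to all of the unit ball.
    let t : ℕ → ℝ≥0 → ℝ := fun N => {u | ‖F u‖ ≤ N}.indicator F
    have hset : ∀ N : ℕ, MeasurableSet {u | ‖F u‖ ≤ (N : ℝ)} := fun N =>
      measurableSet_le hF.measurable.norm measurable_const
    have htm : ∀ N, AEStronglyMeasurable (t N) π := fun N =>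
      (hF.indicator (hset N)).aestronglyMeasurable
    have htN : ∀ N u, ‖t N u‖ ≤ N := fun N u => by
      simp only [t, Set.indicator_apply, Set.mem_ofPred_eq]
      split_ifs with h
      · exact h
      · simp
    have htF : ∀ N u, ‖t N u‖ ≤ ‖F u‖ := fun N u => norm_indicator_le_norm_self _ _
    have hconst : ∀ N, eLpNorm (fun s : ℝ≥0 => ageOp π (t N) s) 2 π ≤ ENNReal.ofReal (√ρ) := by
      intro N
      have hmem : MemLp (t N) 2 π := MemLp.of_bound (htm N) N (ae_of_all _ (htN N))
      have hmem2 : MemLp (fun s : ℝ≥0 => ageOp π (t N) s) 2 π := by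
        have hc := continuous_ageOp π (htm N) (htN N)
        let g : C(ℝ≥0∞, ℝ) := ⟨_, hc⟩
        exact MemLp.of_bound (measurable_ageOp (htm N)).aestronglyMeasurable ‖g‖
          (ae_of_all _ fun s => g.norm_coe_le_norm s)
      have h1 := integral_sq_ageOp_le_of_norm_pow_le hρ hκ hT (htm N) (htN N)
      have h3 : ∫ s, t N s ^ 2 ∂π ≤ 1 := by
        have : eLpNorm (t N) 2 π ≤ 1 := (eLpNorm_mono (htF N)).trans hF1
        rw [eLpNorm_two_eq hmem, ← ENNReal.ofReal_one,
          ENNReal.ofReal_le_ofReal_iff zero_le_one, Real.sqrt_le_iff, one_pow] at this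
        exact this.2
      rw [eLpNorm_two_eq hmem2]
      refine ENNReal.ofReal_le_ofReal (Real.sqrt_le_sqrt ?_)
      nlinarith
    refine (Lp.eLpNorm_lim_le_liminf_eLpNorm
      (fun N => (measurable_ageOp (htm N)).aestronglyMeasurable) _
      (ae_of_all _ fun s => ?_)).trans
      (liminf_le_of_frequently_le' (Frequently.of_forall hconst))
    have hFi : Integrable F π := hFm.integrable one_le_two
    refine tendsto_integral_of_dominated_convergence
      (fun u => ‖(min (s : ℝ≥0∞) (u : ℝ≥0∞)).toReal • F u‖) (fun N => ?_)
      (integrable_smul_min_of_integrable hFi s).norm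
      (fun N => ae_of_all _ fun u => ?_) (ae_of_all _ fun u => ?_)
    · exact (measurable_toReal_min.comp measurable_prodMk_left).aestronglyMeasurable.smul (htm N)
    · rw [norm_smul, norm_smul]
      gcongr
      exact htF N u
    · refine Tendsto.const_smul ?_ _
      obtain ⟨N, hN⟩ := exists_nat_ge ‖F u‖
      refine tendsto_const_nhds.congr' ?_
      filter_upwards [eventually_ge_atTop N] with n hn
      have : ‖F u‖ ≤ n := hN.trans (by exact_mod_cast hn)
      simp only [t, Set.indicator_apply, Set.mem_ofPred_eq, if_pos this]
  refine hle.trans_lt ?_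
  rw [← ENNReal.ofReal_one, ENNReal.ofReal_lt_ofReal_iff one_pos, Real.sqrt_lt' one_pos]
  simpa using hρ1

theorem exists_eigenvector (hπ : AgeCritical π) :
    ∃ (c : ℂ) (y : C(ℝ≥0∞, ℂ)), 1 ≤ ‖c‖ ∧ y ≠ 0 ∧ ageCLM π y = c • y := by
  refine (isCompactOperator_ageCLM π).norm_pow_le_or_exists_eigenvector.resolve_left ?_
  rintro ⟨ρ, h0, h1, h2⟩
  exact absurd hπ (branchingOpNorm_lt_one_of_norm_pow_le h0 h1 h2).ne

/-- Existence of a nonnegative bounded eigenfunction. -/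
theorem exists_eigenfunction (hπ : AgeCritical π) :
    ∃ θ : C(ℝ≥0∞, ℝ), (∀ s, 0 ≤ θ s) ∧ (∀ s, ageOp π (fun u => θ u) s = θ s) ∧
      ∫ u : ℝ≥0, θ u ∂π = 1 := by
  obtain ⟨c, y, hc, hy, hcy⟩ := exists_eigenvector hπ
  let f : ℝ≥0 → ℝ := fun u => ‖y u‖
  have hfm : AEStronglyMeasurable f π := aestronglyMeasurable_coe π y.continuous.norm
  have hfb : ∀ u, ‖f u‖ ≤ ‖y‖ := fun u => by
    simpa [f] using y.norm_coe_le_norm u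
  have hf : MemLp f 2 π := MemLp.of_bound hfm ‖y‖ (ae_of_all _ hfb)
  have hle : ∀ u : ℝ≥0, f u ≤ ageOp π f u := fun u => by
    have h1 : ‖ageCLM π y u‖ = ‖c‖ * f u := by
      rw [hcy, ContinuousMap.smul_apply, norm_smul]
    have h2 : ‖ageCLM π y u‖ ≤ ageOp π f u := norm_ageOp_le _ _
    exact (le_mul_of_one_le_left (norm_nonneg _) hc).trans (h1.symm.le.trans h2)
  have hae := ageOp_ae_eq_of_le hπ hf (fun u => norm_nonneg _) hle
  -- `f = L f` holds only almost everywhere; `η = L f` satisfies the eigenvalue equation at every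
  -- point of `[0, ∞]`.
  let η : C(ℝ≥0∞, ℝ) := ⟨ageOp π f, continuous_ageOp π hfm hfb⟩
  have hη0 : ∀ s, 0 ≤ η s := ageOp_nonneg fun u => norm_nonneg _
  have hη : ∀ s, ageOp π (fun u => η u) s = η s := fun s => by
    change ageOp π (fun u : ℝ≥0 => ageOp π f u) s = ageOp π f s
    rw [ageOp_congr_ae hae]
  have hηi : Integrable (fun u : ℝ≥0 => η u) π :=
    Integrable.of_bound (aestronglyMeasurable_coe π η.continuous) ‖η‖
      (ae_of_all _ fun u => η.norm_coe_le_norm u)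
  have hpos : ∫ u : ℝ≥0, η u ∂π ≠ 0 := by
    intro h0
    have h1 : (fun u : ℝ≥0 => η u) =ᵐ[π] 0 :=
      (integral_eq_zero_iff_of_nonneg (fun u : ℝ≥0 => hη0 u) hηi).1 h0
    have h2 : (fun u : ℝ≥0 => y u) =ᵐ[π] fun _ => 0 := by
      filter_upwards [hae, h1] with u hu hu1
      have : f u = 0 := hu.symm.trans hu1
      simpa [f] using this
    refine hy ?_
    have h3 : ageCLM π y = 0 := by
      ext s
      rw [ageCLM_apply, ageOp_congr_ae h2]
      simp [ageOp]
    have hc0 : c ≠ 0 := by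
      rintro rfl
      norm_num at hc
    exact (smul_eq_zero.1 (hcy.symm.trans h3)).resolve_left hc0
  refine ⟨(∫ u : ℝ≥0, η u ∂π)⁻¹ • η, fun s => ?_, fun s => ?_, ?_⟩
  · exact mul_nonneg (inv_nonneg.2 (integral_nonneg fun u => hη0 u)) (hη0 s)
  · simp only [ContinuousMap.smul_apply, smul_eq_mul]
    rw [ageOp_const_mul, hη]
  · simp only [ContinuousMap.smul_apply, smul_eq_mul]
    rw [integral_const_mul, inv_mul_cancel₀ hpos]

end SpectralRadius

/-! ### Simplicity of the eigenvalue, almost sure finiteness, small solutions. -/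

section Eigenfunction

variable {π : Measure ℝ≥0} [IsProbabilityMeasure π] [HasFiniteMean π]

theorem integrable_continuousMap (π : Measure ℝ≥0) [IsFiniteMeasure π] {E : Type*}
    [NormedAddCommGroup E] (f : C(ℝ≥0∞, E)) : Integrable (fun u : ℝ≥0 => f u) π :=
  Integrable.of_bound (aestronglyMeasurable_coe π f.continuous) ‖f‖
    (ae_of_all _ fun u => f.norm_coe_le_norm u)

theorem memLp_continuousMap (π : Measure ℝ≥0) [IsFiniteMeasure π] {E : Type*}
    [NormedAddCommGroup E] (f : C(ℝ≥0∞, E)) : MemLp (fun u : ℝ≥0 => f u) 2 π :=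
  MemLp.of_bound (aestronglyMeasurable_coe π f.continuous) ‖f‖
    (ae_of_all _ fun u => f.norm_coe_le_norm u)

/-- A continuous nonnegative `θ` on `[0, ∞]` with `L_π θ = θ` and `∫ θ dπ = 1`. -/
structure IsPositiveEigenfunction (π : Measure ℝ≥0) (θ : C(ℝ≥0∞, ℝ)) : Prop where
  nonneg : ∀ s, 0 ≤ θ s
  ageOp_eq : ∀ s, ageOp π (fun u => θ u) s = θ s
  integral_eq_one : ∫ u : ℝ≥0, θ u ∂π = 1

variable {θ : C(ℝ≥0∞, ℝ)} (hθ : IsPositiveEigenfunction π θ)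

omit [IsProbabilityMeasure π] in
include hθ in
-- A zero at some `s > 0` would force `θ = 0` almost everywhere, against `∫ θ dπ = 1`.
theorem IsPositiveEigenfunction.pos {s : ℝ≥0∞} (hs : 0 < s) : 0 < θ s := by
  refine (hθ.nonneg s).lt_of_ne' fun h => ?_
  have h0 : θ 0 = 0 := by
    rw [← hθ.ageOp_eq 0, ageOp_zero_right]
  have h1 := ae_eq_zero_of_ageOp_eq_zero (π := π) (f := fun u => θ u) (fun u => hθ.nonneg u)
    (by simpa using h0) hs (integrable_smul_min π (aestronglyMeasurable_coe π θ.continuous)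
      (fun u => θ.norm_coe_le_norm u) s) (by rw [hθ.ageOp_eq, h])
  have h2 := hθ.integral_eq_one
  rw [integral_congr_ae h1] at h2
  simp at h2

omit [HasFiniteMean π] in
/-- An eigenfunction with mean zero vanishes. -/
theorem eq_zero_of_ageOp_eq (hπ : AgeCritical π) {f : ℝ≥0 → ℝ} (hf : MemLp f 2 π)
    (hL : ∀ u : ℝ≥0, ageOp π f u = f u) (hi : ∫ u, f u ∂π = 0) (u : ℝ≥0) : f u = 0 := by
  have hfi : Integrable f π := hf.integrable one_le_two
  have hf0 : f 0 = 0 := by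
    have := hL 0
    rw [← this, ENNReal.coe_zero, ageOp_zero_right]
  suffices h : f =ᵐ[π] 0 by
    rw [← hL, ageOp_congr_ae h]
    simp [ageOp]
  have hg : MemLp (fun u => ‖f u‖) 2 π := hf.norm
  have hgL := ageOp_ae_eq_of_le hπ hg (fun u => norm_nonneg _) fun u => by
    rw [← hL u]
    exact norm_ageOp_le f u
  -- Both `|f|` and `f` are fixed by `L` up to null sets, hence so is `k ≥ 0`. Either `k = 0` almost
  -- everywhere, or `L k > 0` away from the age 0. Thus `f` has constant sign, and mean zero makes
  -- it vanish.
  let k : ℝ≥0 → ℝ := fun u => ‖f u‖ - f u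
  have hk : MemLp k 2 π := hg.sub hf
  have hk0 : ∀ u, 0 ≤ k u := fun u => sub_nonneg.2 (le_abs_self _)
  have hki : ∀ s : ℝ≥0, Integrable (fun u : ℝ≥0 => (min (s : ℝ≥0∞) (u : ℝ≥0∞)).toReal • k u) π :=
    integrable_smul_min_of_integrable (hk.integrable one_le_two)
  have hkL : (fun u : ℝ≥0 => ageOp π k u) =ᵐ[π] k := by
    filter_upwards [hgL] with u hu
    have hs := ageOp_sub (π := π) (s := u)
      (integrable_smul_min_of_integrable (hg.integrable one_le_two) u)
      (integrable_smul_min_of_integrable hfi u)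
    change ageOp π (fun u => ‖f u‖ - f u) u = ‖f u‖ - f u
    rw [hs, hu, hL]
  have hsign : f ≤ᵐ[π] 0 ∨ 0 ≤ᵐ[π] f := by
    by_cases hz : k =ᵐ[π] 0
    · right
      filter_upwards [hz] with u hu
      have : ‖f u‖ = f u := sub_eq_zero.1 hu
      rw [Pi.zero_apply, ← this]
      exact norm_nonneg _
    · left
      filter_upwards [hkL] with u hu
      rcases eq_or_ne u 0 with rfl | hu0
      · exact hf0.le
      · have : k u ≠ 0 := fun h => hz (ae_eq_zero_of_ageOp_eq_zero hk0 (by simp [k, hf0])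
          (by simpa [pos_iff_ne_zero] using hu0) (hki u) (hu.trans h))
        by_contra! h
        exact this (by simp [k, abs_of_pos (show 0 < f u from h)])
  rcases hsign with h | h
  · have := (integral_eq_zero_iff_of_nonneg_ae (f := fun u => -f u)
      (h.mono fun u hu => neg_nonneg.2 hu) hfi.neg).1 (by rw [integral_neg, hi, neg_zero])
    exact this.mono fun u hu => neg_eq_zero.1 hu
  · exact (integral_eq_zero_iff_of_nonneg_ae h hfi).1 hi

include hθ

omit [HasFiniteMean π] in
/-- The eigenvalue `1` is simple. -/
theorem IsPositiveEigenfunction.eq_integral_mul (hπ : AgeCritical π) {f : ℝ≥0 → ℝ}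
    (hf : MemLp f 2 π) (hL : ∀ u : ℝ≥0, ageOp π f u = f u) (u : ℝ≥0) :
    f u = (∫ u, f u ∂π) * θ u := by
  set c := ∫ u, f u ∂π with hc
  have hθm : MemLp (fun u : ℝ≥0 => c * θ u) 2 π := (memLp_continuousMap π θ).const_mul c
  have := eq_zero_of_ageOp_eq hπ (f := fun u => f u - c * θ u) (hf.sub hθm) (fun u => ?_) ?_ u
  · exact sub_eq_zero.1 this
  · rw [ageOp_sub (integrable_smul_min_of_integrable (hf.integrable one_le_two) u)
      (integrable_smul_min_of_integrable (hθm.integrable one_le_two) u), ageOp_const_mul,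
      hθ.ageOp_eq, hL]
  · rw [integral_sub (hf.integrable one_le_two) (hθm.integrable one_le_two), integral_const_mul,
      hθ.integral_eq_one, mul_one, sub_self]

omit [HasFiniteMean π] in
theorem IsPositiveEigenfunction.isPrincipalEigenfunction (hπ : AgeCritical π) :
    IsPrincipalEigenfunction π θ where
  memLp := memLp_continuousMap π θ
  eigen s := by
    rw [branchingOp_eq, hθ.ageOp_eq, show branchingOpNorm π = 1 from hπ]
    simp
  integral_eq_one := hθ.integral_eq_one
  tendsto_top := (θ.continuous.tendsto ∞).comp (ENNReal.tendsto_coe_nhds_top.2 tendsto_id)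

theorem IsPositiveEigenfunction.eq_of_isPrincipalEigenfunction (hπ : AgeCritical π)
    {θ' : ℝ≥0∞ → ℝ} (h : IsPrincipalEigenfunction π θ') : θ' = θ := by
  have hcoe : ∀ u : ℝ≥0, θ' u = θ u := fun u => by
    have := hθ.eq_integral_mul hπ h.memLp (fun u => ?_) u
    · rwa [h.integral_eq_one, one_mul] at this
    · have := h.eigen u
      rwa [branchingOp_eq, show branchingOpNorm π = 1 from hπ, ENNReal.toReal_one, one_mul] at this
  funext s
  induction s with
  | top =>
    refine tendsto_nhds_unique h.tendsto_top ?_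
    simp_rw [hcoe]
    exact (hθ.isPrincipalEigenfunction hπ).tendsto_top
  | coe u => exact hcoe u

theorem IsPositiveEigenfunction.eq_smul_of_ageCLM_eq (hπ : AgeCritical π) {y : C(ℝ≥0∞, ℂ)}
    (hy : ageCLM π y = y) (s : ℝ≥0∞) : y s = (∫ u : ℝ≥0, y u ∂π) * θ s := by
  have hys : ∀ s, ageOp π (fun u => y u) s = y s := fun s => DFunLike.congr_fun hy s
  have hyi := integrable_continuousMap π y
  have hcomp : ∀ (ℓ : ℂ →L[ℝ] ℝ) (u : ℝ≥0), ℓ (y u) = ℓ (∫ u : ℝ≥0, y u ∂π) * θ u := by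
    intro ℓ u
    rw [← ContinuousLinearMap.integral_comp_comm ℓ hyi]
    refine hθ.eq_integral_mul hπ (f := fun u => ℓ (y u)) (ℓ.comp_memLp' (memLp_continuousMap π y))
      (fun u => ?_) u
    rw [← hys u, ageOp, ageOp, ← ContinuousLinearMap.integral_comp_comm ℓ
      (integrable_smul_min_continuousMap π y u)]
    simp_rw [map_smul]
  have hcoe : ∀ u : ℝ≥0, y u = (∫ u : ℝ≥0, y u ∂π) * θ u := fun u => by
    apply Complex.ext
    · simpa using hcomp Complex.reCLM u
    · simpa using hcomp Complex.imCLM u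
  have hfun : (fun u : ℝ≥0 => y u) = fun u : ℝ≥0 => (∫ u : ℝ≥0, y u ∂π) * ((θ u : ℝ) : ℂ) :=
    funext hcoe
  -- One more application of `L` carries the identity from finite ages to `s = ∞`.
  have h1 : y s = ageOp π (fun u : ℝ≥0 => (∫ u : ℝ≥0, y u ∂π) * ((θ u : ℝ) : ℂ)) s := by
    rw [← hfun, hys]
  rw [h1, ageOp_const_mul, ageOp_ofReal, hθ.ageOp_eq]

omit [HasFiniteMean π] in
theorem IsPositiveEigenfunction.integral_pow_pos {n : ℕ} (hn : n ≠ 0) :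
    0 < ∫ u : ℝ≥0, θ u ^ n ∂π := by
  have hi : Integrable (fun u : ℝ≥0 => θ u ^ n) π := integrable_continuousMap π (θ ^ n)
  refine (integral_nonneg fun u : ℝ≥0 => pow_nonneg (hθ.nonneg u) n).lt_of_ne' fun h => ?_
  have h1 := (integral_eq_zero_iff_of_nonneg
    (fun u : ℝ≥0 => pow_nonneg (hθ.nonneg u) n) hi).1 h
  have h2 : (fun u : ℝ≥0 => θ u) =ᵐ[π] fun _ => 0 := h1.mono fun u hu => (pow_eq_zero_iff hn).1 hu
  have h3 := hθ.integral_eq_one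
  rw [integral_congr_ae h2] at h3
  simp at h3

/-- By symmetry, `θ` is also a left eigenvector. -/
theorem IsPositiveEigenfunction.integral_ageOp_mul {f : ℝ≥0 → ℂ} {C : ℝ}
    (hf : AEStronglyMeasurable f π) (hC : ∀ u, ‖f u‖ ≤ C) :
    ∫ u : ℝ≥0, ageOp π f u * θ u ∂π = ∫ u : ℝ≥0, f u * θ u ∂π := by
  have := AgeTree.integral_ageOp_mul (π := π) (𝕜 := ℂ) (g := fun u => ((θ u : ℝ) : ℂ)) hf hC
    (Complex.continuous_ofReal.comp_aestronglyMeasurable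
      (aestronglyMeasurable_coe π θ.continuous)) (D := ‖θ‖) (fun u => by
        rw [Complex.norm_real]
        exact θ.norm_coe_le_norm u)
  rw [this]
  congr 1
  funext u
  rw [ageOp_ofReal, hθ.ageOp_eq]

/-- A critical tree is almost surely finite. -/
theorem IsPositiveEigenfunction.finiteProb_eq_one (s : ℝ≥0∞) : finiteProb π s = 1 := by
  let p : ℝ≥0 → ℝ := fun u => 1 - finiteProb π u
  have hpm : AEStronglyMeasurable p π := (measurable_const.sub
    ((measurable_finiteProb π).comp measurable_coe_nnreal_ennreal)).aestronglyMeasurable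
  have hp0 : ∀ u, 0 ≤ p u := fun u => sub_nonneg.2 (finiteProb_le_one π u)
  have hp1 : ∀ u, ‖p u‖ ≤ 1 := fun u => by
    rw [Real.norm_of_nonneg (hp0 u)]
    exact sub_le_self _ (finiteProb_nonneg π u)
  let y : C(ℝ≥0∞, ℝ) := ⟨ageOp π p, continuous_ageOp π hpm hp1⟩
  have hy0 : ∀ s, 0 ≤ y s := ageOp_nonneg hp0
  have hfp : ∀ s, finiteProb π s = Real.exp (-y s) := finiteProb_eq π
  have hpy : ∀ u : ℝ≥0, p u = 1 - Real.exp (-y u) := fun u => by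
    rw [← hfp]
  have hpi : Integrable p π := Integrable.of_bound hpm 1 (ae_of_all _ hp1)
  have h1 : ∫ u : ℝ≥0, y u * θ u ∂π = ∫ u : ℝ≥0, p u * θ u ∂π := by
    have := AgeTree.integral_ageOp_mul (π := π) (𝕜 := ℝ) (g := fun u => θ u) hpm hp1
      (aestronglyMeasurable_coe π θ.continuous) (fun u => θ.norm_coe_le_norm u)
    simp_rw [hθ.ageOp_eq] at this
    exact this
  have hle : ∀ u : ℝ≥0, 0 ≤ (y u - p u) * θ u := fun u => by
    refine mul_nonneg (sub_nonneg.2 ?_) (hθ.nonneg u)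
    rw [hpy]
    -- With `y = L p` and `p = 1 - e^{-y} ≤ y`, the pairings of `y` and `p` with `θ` agree, so
    -- equality holds almost everywhere. The exponential inequality is strict unless `y = 0`.
    linarith [Real.add_one_le_exp (-y u)]
  have hyi : Integrable (fun u : ℝ≥0 => y u * θ u) π := integrable_continuousMap π (y * θ)
  have hpθ : Integrable (fun u : ℝ≥0 => p u * θ u) π :=
    hpi.mul_bdd (c := ‖θ‖) (aestronglyMeasurable_coe π θ.continuous)
      (ae_of_all _ fun u => θ.norm_coe_le_norm u)
  have hi : Integrable (fun u : ℝ≥0 => (y u - p u) * θ u) π := by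
    simp_rw [sub_mul]
    exact hyi.sub hpθ
  have h2 : ∫ u : ℝ≥0, (y u - p u) * θ u ∂π = 0 := by
    simp_rw [sub_mul]
    rw [integral_sub hyi hpθ, h1, sub_self]
  have h3 : p =ᵐ[π] 0 := by
    filter_upwards [(integral_eq_zero_iff_of_nonneg hle hi).1 h2] with u hu
    have hyu : y u = 0 := by
      rcases eq_or_ne u 0 with rfl | hu0
      · change ageOp π p ((0 : ℝ≥0) : ℝ≥0∞) = 0
        rw [ENNReal.coe_zero, ageOp_zero_right]
      · have hθu : θ u ≠ 0 := (hθ.pos (by simpa [pos_iff_ne_zero] using hu0)).ne'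
        have h4 : y u - p u = 0 := (mul_eq_zero.1 hu).resolve_right hθu
        rw [hpy] at h4
        by_contra h5
        have := Real.add_one_lt_exp (x := -y u) (neg_ne_zero.2 h5)
        linarith
    rw [hpy, hyu]
    simp
  have h4 : y s = 0 := by
    change ageOp π p s = 0
    rw [ageOp_congr_ae h3]
    simp [ageOp]
  rw [hfp, h4, neg_zero, Real.exp_zero]

/-- Near `z = 1`, the generating functions are described by a small continuous solution of the
fixed point equation. -/
theorem IsPositiveEigenfunction.eventually_exists_small_solution {δ : ℝ} (hδ : 0 < δ) :
    ∀ᶠ z in 𝓝[Metric.ball (0 : ℂ) 1] 1, ∃ y : C(ℝ≥0∞, ℂ), ‖y‖ < δ ∧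
      (∀ s, genFun (treeLawFrom π s) z = z * Complex.exp (-y s)) ∧
      (∀ s, y s = ageOp π (fun u => 1 - z * Complex.exp (-y u)) s) ∧ ∀ s, 0 ≤ (y s).re := by
  -- Since `s ∧ u ≤ u`, this integral bounds `y` uniformly in `s`; it tends to 0 because the tree is
  -- almost surely finite.
  have htend : Tendsto (fun z => ∫ u : ℝ≥0, (u : ℝ) * ‖1 - genFun (treeLawFrom π u) z‖ ∂π)
      (𝓝[Metric.ball (0 : ℂ) 1] 1) (𝓝 0) := by
    have h0 : ∫ u : ℝ≥0, (u : ℝ) * ‖(0 : ℂ)‖ ∂π = 0 := by simp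
    rw [← h0]
    refine tendsto_integral_filter_of_dominated_convergence (fun u : ℝ≥0 => (u : ℝ) * 2) ?_ ?_
      ((integrable_coe π).mul_const 2) (ae_of_all _ fun u => ?_)
    · filter_upwards [eventually_norm_lt_one] with z hz
      exact (measurable_coe_nnreal_real.mul (measurable_const.sub ((measurable_genFun π hz).comp
        measurable_coe_nnreal_ennreal)).norm).aestronglyMeasurable
    · filter_upwards [eventually_norm_lt_one] with z hz
      refine ae_of_all _ fun u => ?_
      rw [norm_mul, norm_norm, Real.norm_of_nonneg u.coe_nonneg, norm_sub_rev]
      gcongr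
      exact norm_sub_one_le_two (norm_genFun_le_one _ hz.le)
    · refine (Tendsto.norm ?_).const_mul _
      have := (tendsto_genFun_one π u).const_sub 1
      rwa [hθ.finiteProb_eq_one, Complex.ofReal_one, sub_self] at this
  filter_upwards [eventually_norm_lt_one, htend.eventually_lt_const hδ] with z hz hzδ
  have hm : AEStronglyMeasurable (fun u : ℝ≥0 => 1 - genFun (treeLawFrom π u) z) π :=
    (measurable_const.sub ((measurable_genFun π hz).comp
      measurable_coe_nnreal_ennreal)).aestronglyMeasurable
  have hb : ∀ u : ℝ≥0, ‖1 - genFun (treeLawFrom π u) z‖ ≤ 2 := fun u => by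
    rw [norm_sub_rev]
    exact norm_sub_one_le_two (norm_genFun_le_one _ hz.le)
  let y : C(ℝ≥0∞, ℂ) := ⟨ageOp π fun u => 1 - genFun (treeLawFrom π u) z,
    continuous_ageOp π hm hb⟩
  have hg : ∀ s, genFun (treeLawFrom π s) z = z * Complex.exp (-y s) := fun s => by
    rw [genFun_eq π hz s]
    congr 2
    change _ = -ageOp π (fun u : ℝ≥0 => 1 - genFun (treeLawFrom π u) z) s
    rw [ageOp, ageOp, ← integral_neg]
    congr 1
    funext u
    rw [← smul_neg, neg_sub]
  refine ⟨y, ?_, hg, fun s => ?_, fun s => ?_⟩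
  · refine lt_of_le_of_lt ?_ hzδ
    rw [ContinuousMap.norm_le _ (integral_nonneg fun u => by positivity)]
    intro s
    refine norm_integral_le_of_norm_le (((integrable_coe π).mul_const 2).mono'
      (measurable_coe_nnreal_real.aestronglyMeasurable.mul hm.norm) (ae_of_all _ fun u => ?_))
      (ae_of_all _ fun u => ?_)
    · rw [norm_mul, norm_norm, Real.norm_of_nonneg u.coe_nonneg]
      gcongr
      exact hb u
    · rw [norm_smul, Real.norm_of_nonneg ENNReal.toReal_nonneg]
      gcongr
      exact toReal_min_le s u
  · simp_rw [← hg]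
    rfl
  · have h1 : (y s).re = ageOp π (fun u : ℝ≥0 => (1 - genFun (treeLawFrom π u) z).re) s := by
      change (ageOp π (fun u : ℝ≥0 => 1 - genFun (treeLawFrom π u) z) s).re = _
      rw [ageOp, ageOp, ← Complex.reCLM_apply, ← ContinuousLinearMap.integral_comp_comm _
        (integrable_smul_min π hm hb s)]
      simp_rw [map_smul, Complex.reCLM_apply]
    rw [h1]
    refine ageOp_nonneg (fun u => ?_) s
    rw [Complex.sub_re, Complex.one_re, sub_nonneg]
    exact (Complex.re_le_norm _).trans (norm_genFun_le_one _ hz.le)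

end Eigenfunction

/-! ### The square root singularity at a simple eigenvalue. -/

section SquareRoot

variable {X : Type*} [NormedRing X] [NormedAlgebra ℂ X] [CompleteSpace X]
  {T : X →L[ℂ] X} {ℓ : X →L[ℂ] ℂ} {v : X}

/-- The linear map `(y, ε) ↦ (y - T y - ε w, ℓ y)`. -/
noncomputable def borderedMap (T : X →L[ℂ] X) (ℓ : X →L[ℂ] ℂ) (w : X) : X × ℂ →L[ℂ] X × ℂ :=
  (ContinuousLinearMap.fst ℂ X ℂ - T.comp (ContinuousLinearMap.fst ℂ X ℂ) -
    (ContinuousLinearMap.snd ℂ X ℂ).smulRight w).prod (ℓ.comp (ContinuousLinearMap.fst ℂ X ℂ))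

omit [CompleteSpace X] in
theorem borderedMap_apply (T : X →L[ℂ] X) (ℓ : X →L[ℂ] ℂ) (w : X) (p : X × ℂ) :
    borderedMap T ℓ w p = (p.1 - T p.1 - p.2 • w, ℓ p.1) := rfl

/-- `1 - T` misses one dimension in kernel and range. The coordinate `ℓ` detects the kernel, spanned
by `v`, and the direction `w` with `ℓ w = 1` complements the range, on which `ℓ` vanishes. -/
theorem borderedMap_bijective (hT : IsCompactOperator T)
    (hℓ : ∀ y, ℓ (T y) = ℓ y) (hv : ℓ v = 1) (hker : ∀ y, T y = y → ∃ c : ℂ, y = c • v)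
    {w : X} (hw : ℓ w = 1) : Function.Bijective (borderedMap T ℓ w) := by
  have hzero : ∀ y, T y = y → ℓ y = 0 → y = 0 := fun y hy h0 => by
    obtain ⟨c, rfl⟩ := hker y hy
    rw [map_smul, hv, smul_eq_mul, mul_one] at h0
    rw [h0, zero_smul]
  constructor
  · refine (injective_iff_map_eq_zero _).2 fun p hp => ?_
    rw [borderedMap_apply, Prod.mk_eq_zero] at hp
    have h1 : p.2 = 0 := by
      have := congrArg ℓ hp.1
      simpa [hℓ, hw] using this
    have h2 := hp.1
    rw [h1, zero_smul, sub_zero, sub_eq_zero] at h2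
    exact Prod.ext (hzero _ h2.symm hp.2) h1
  -- The rank one correction removes the eigenvalue 1 and keeps the operator compact, so `1 - K` is
  -- invertible by the Fredholm alternative.
  · let K : X →L[ℂ] X := T - ℓ.smulRight v
    have hrank : IsCompactOperator (ℓ.smulRight v) := by
      have : IsCompactOperator ((ContinuousLinearMap.id ℂ ℂ).smulRight v) :=
        isCompactOperator_of_locallyCompactSpace_rng _
      exact this.comp_clm ℓ
    have hK : IsCompactOperator K := hT.sub hrank
    have hunit : IsUnit (1 - K) := by
      have := (hK.hasEigenvalue_or_mem_resolventSet (μ := 1) one_ne_zero).resolve_left fun h => by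
        obtain ⟨y, hy⟩ := h.exists_hasEigenvector
        have h1 : T y - ℓ y • v = y := by simpa [K] using hy.apply_eq_smul
        have h2 : ℓ y = 0 := by
          have := congrArg ℓ h1
          simpa [hℓ, hv] using this.symm
        rw [h2, zero_smul, sub_zero] at h1
        exact hy.2 (hzero y h1 h2)
      simpa [resolventSet] using this
    rintro ⟨f, a⟩
    -- The right-hand side is chosen so that applying `ℓ` yields `ℓ y = a`; the term `a • v` then
    -- cancels the correction.
    obtain ⟨y, hy⟩ := (ContinuousLinearMap.isUnit_iff_bijective.1 hunit).2
      (f + (-ℓ f) • w + a • v)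
    have hy' : y - (T y - ℓ y • v) = f + (-ℓ f) • w + a • v := by simpa [K] using hy
    have hℓy : ℓ y = a := by
      have := congrArg ℓ hy'
      simpa [hℓ, hv, hw] using this
    refine ⟨(y, -ℓ f), ?_⟩
    rw [borderedMap_apply]
    refine Prod.ext ?_ hℓy
    rw [hℓy] at hy'
    linear_combination (norm := module) hy'

theorem exp_neg_sub_isBigO :
    (fun y : X => NormedSpace.exp (-y) - 1 + y - (1 / 2 : ℂ) • (y * y)) =O[𝓝 0]
      fun y => ‖y‖ ^ 3 := by
  have h := (NormedSpace.exp_hasFPowerSeriesAt_zero (𝕂 := ℂ) (𝔸 := X)).isBigO_sub_partialSum_pow 3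
  have hneg : Tendsto (fun y : X => -y) (𝓝 0) (𝓝 0) := by
    simpa using (continuous_neg (G := X)).tendsto 0
  refine (h.comp_tendsto hneg).congr (fun y => ?_) fun y => by simp
  simp only [Function.comp_apply, zero_add, FormalMultilinearSeries.partialSum,
    Finset.sum_range_succ, Finset.sum_range_zero, NormedSpace.expSeries_apply_eq]
  simp only [Nat.factorial, pow_two, pow_zero, pow_one]
  norm_num
  abel

/-- The solutions of `y = T (1 - (1 - ε) e^{-y})` near the origin form an analytic curve,
parametrised by `ℓ y`. -/
theorem exists_solution_curve (hT : IsCompactOperator T)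
    (hℓ : ∀ y, ℓ (T y) = ℓ y) (hv : ℓ v = 1) (hker : ∀ y, T y = y → ∃ c : ℂ, y = c • v)
    (hTv : T v = v) (h1 : ℓ 1 = 1) :
    ∃ (Y : ℂ → X) (e : ℂ → ℂ), AnalyticAt ℂ Y 0 ∧ AnalyticAt ℂ e 0 ∧ Y 0 = 0 ∧ e 0 = 0 ∧
      HasDerivAt Y v 0 ∧ HasDerivAt e 0 0 ∧
      (∀ᶠ a in 𝓝 0, Y a = T (1 - (1 - e a) • NormedSpace.exp (-Y a))) ∧
      ∀ᶠ p : X × ℂ in 𝓝 0, p.1 = T (1 - (1 - p.2) • NormedSpace.exp (-p.1)) →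
        Y (ℓ p.1) = p.1 ∧ e (ℓ p.1) = p.2 := by
  let F : X × ℂ → X × ℂ := fun p =>
    (p.1 - T (1 - (1 - p.2) • NormedSpace.exp (-p.1)), ℓ p.1)
  let A : (X × ℂ) ≃L[ℂ] (X × ℂ) := ContinuousLinearEquiv.ofBijective (borderedMap T ℓ (T 1))
    (LinearMap.ker_eq_bot.2 (borderedMap_bijective hT hℓ hv hker (by rw [hℓ, h1])).1)
    (LinearMap.range_eq_top.2 (borderedMap_bijective hT hℓ hv hker (by rw [hℓ, h1])).2)
  have hA : (A : (X × ℂ) →L[ℂ] (X × ℂ)) = borderedMap T ℓ (T 1) := by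
    ext p <;> rfl
  have hF0 : F 0 = 0 := by simp [F]
  have hexp : AnalyticAt ℂ (fun p : X × ℂ => NormedSpace.exp (-p.1)) 0 :=
    AnalyticAt.comp (g := NormedSpace.exp) (f := fun p : X × ℂ => -p.1)
      (NormedSpace.exp_analytic _) analyticAt_fst.neg
  have hFa : AnalyticAt ℂ F 0 := by
    refine AnalyticAt.prod (analyticAt_fst.sub ?_) ?_
    · exact (T.analyticAt _).comp
        (analyticAt_const.sub ((analyticAt_const.sub analyticAt_snd).smul hexp))
    · exact (ℓ.analyticAt _).comp analyticAt_fst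
  have hFd : HasFDerivAt F (borderedMap T ℓ (T 1)) 0 := by
    have hfst : HasFDerivAt (fun p : X × ℂ => p.1) (ContinuousLinearMap.fst ℂ X ℂ) 0 :=
      hasFDerivAt_fst
    have hsnd : HasFDerivAt (fun p : X × ℂ => p.2) (ContinuousLinearMap.snd ℂ X ℂ) 0 :=
      hasFDerivAt_snd
    have he : HasFDerivAt (fun p : X × ℂ => NormedSpace.exp (-p.1))
        ((1 : X →L[ℂ] X).comp (-ContinuousLinearMap.fst ℂ X ℂ)) 0 := by
      refine HasFDerivAt.comp (g := NormedSpace.exp) (0 : X × ℂ) ?_ hfst.neg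
      simpa using hasFDerivAt_exp_zero (𝕂 := ℂ) (𝔸 := X)
    have hs := (hsnd.const_sub 1).smul he
    have := (hfst.sub (T.hasFDerivAt.comp 0 (hs.const_sub 1))).prodMk (ℓ.hasFDerivAt.comp 0 hfst)
    refine this.congr_fderiv ?_
    ext p <;> simp [borderedMap]
  have hstrict : HasStrictFDerivAt F (A : (X × ℂ) →L[ℂ] (X × ℂ)) 0 := by
    rw [hA, ← hFd.fderiv]
    exact hFa.hasStrictFDerivAt
  let R := hstrict.toOpenPartialHomeomorph F
  have hR : (R : X × ℂ → X × ℂ) = F := hstrict.toOpenPartialHomeomorph_coe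
  have hmem : (0 : X × ℂ) ∈ R.source := hstrict.mem_toOpenPartialHomeomorph_source
  let G : X × ℂ → X × ℂ := R.symm
  have hG0 : G 0 = 0 := by
    have := R.left_inv hmem
    rwa [hR, hF0] at this
  have hGa : AnalyticAt ℂ G 0 := by
    have := R.analyticAt_symm' (i := A) hmem (by rw [hR]; exact hFa)
      (by rw [hR, hFd.fderiv, hA])
    rwa [hR, hF0] at this
  have hGd : HasFDerivAt G (A.symm : (X × ℂ) →L[ℂ] (X × ℂ)) 0 := by
    have := hstrict.to_localInverse.hasFDerivAt
    rwa [hF0] at this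
  have hleft : ∀ᶠ p in 𝓝 0, G (F p) = p := hstrict.eventually_left_inverse
  have hright : ∀ᶠ q in 𝓝 0, F (G q) = q := by
    have := hstrict.eventually_right_inverse
    rwa [hF0] at this
  have hι : AnalyticAt ℂ (fun a : ℂ => ((0 : X), a)) 0 := analyticAt_const.prod analyticAt_id
  have hιd : HasDerivAt (fun a : ℂ => ((0 : X), a)) (0, 1) 0 :=
    (hasDerivAt_const _ _).prodMk (hasDerivAt_id _)
  have hC : AnalyticAt ℂ (fun a : ℂ => G (0, a)) 0 := AnalyticAt.comp (g := G) hGa hι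
  -- The tangent of the curve at 0 is `(v, 0)`: `y` moves along `v`, and `ε` is stationary.
  have hAv : A.symm (0, 1) = (v, 0) := by
    rw [ContinuousLinearEquiv.symm_apply_eq]
    change _ = borderedMap T ℓ (T 1) (v, 0)
    rw [borderedMap_apply]
    simp [hTv, hv]
  have hCd : HasDerivAt (fun a : ℂ => G (0, a)) (v, 0) 0 := by
    have := HasFDerivAt.comp_hasDerivAt (0 : ℂ) (l := G) (f := fun a : ℂ => ((0 : X), a)) hGd hιd
    rw [← hAv]
    exact this
  refine ⟨fun a => (G (0, a)).1, fun a => (G (0, a)).2, analyticAt_fst.comp hC,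
    analyticAt_snd.comp hC, by simp [← Prod.zero_eq_mk, hG0], by simp [← Prod.zero_eq_mk, hG0],
    (ContinuousLinearMap.fst ℂ X ℂ).hasFDerivAt.comp_hasDerivAt (0 : ℂ) hCd,
    (ContinuousLinearMap.snd ℂ X ℂ).hasFDerivAt.comp_hasDerivAt (0 : ℂ) hCd,
    ?_, ?_⟩
  · have hι0 : Tendsto (fun a : ℂ => ((0 : X), a)) (𝓝 0) (𝓝 0) := hι.continuousAt
    filter_upwards [hι0.eventually hright] with a ha
    exact sub_eq_zero.1 (congrArg Prod.fst ha)
  · filter_upwards [hleft] with p hp hsol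
    have : F p = (0, ℓ p.1) := Prod.ext (sub_eq_zero.2 hsol) rfl
    rw [this] at hp
    exact ⟨congrArg Prod.fst hp, congrArg Prod.snd hp⟩

theorem analyticAt_dslope {E : Type*} [NormedAddCommGroup E] [NormedSpace ℂ E] {f : ℂ → E} {a : ℂ}
    (hf : AnalyticAt ℂ f a) : AnalyticAt ℂ (dslope f a) a := by
  obtain ⟨p, hp⟩ := hf
  exact ⟨_, hp.has_fpower_series_dslope_fslope⟩

/-- Along the curve of solutions, `ε` vanishes to second order, with an explicit coefficient. -/
theorem exists_eq_sq_mul {Y : ℂ → X} {e : ℂ → ℂ} (hℓ : ∀ y, ℓ (T y) = ℓ y) (h1 : ℓ 1 = 1)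
    (hY : AnalyticAt ℂ Y 0) (he : AnalyticAt ℂ e 0) (hY0 : Y 0 = 0) (he0 : e 0 = 0)
    (hYd : HasDerivAt Y v 0) (hed : HasDerivAt e 0 0)
    (hsol : ∀ᶠ a in 𝓝 0, Y a = T (1 - (1 - e a) • NormedSpace.exp (-Y a))) :
    ∃ E : ℂ → ℂ, AnalyticAt ℂ E 0 ∧ E 0 = ℓ (v * v) / 2 ∧ ∀ a, e a = a ^ 2 * E a := by
  let V := dslope Y 0
  have hV : AnalyticAt ℂ V 0 := analyticAt_dslope hY
  have hV0 : V 0 = v := (dslope_same Y 0).trans hYd.deriv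
  have hYV : ∀ a, Y a = a • V a := fun a => by
    have := sub_smul_dslope Y 0 a
    simpa [hY0] using this.symm
  let E₁ := dslope e 0
  let E := dslope E₁ 0
  have hE₁ : AnalyticAt ℂ E₁ 0 := analyticAt_dslope he
  have hE : AnalyticAt ℂ E 0 := analyticAt_dslope hE₁
  have hE₁0 : E₁ 0 = 0 := (dslope_same e 0).trans hed.deriv
  have heE : ∀ a, e a = a ^ 2 * E a := fun a => by
    have h2 : a * E₁ a = e a := by simpa [he0] using sub_smul_dslope e 0 a
    have h3 : a * E a = E₁ a := by simpa [hE₁0] using sub_smul_dslope E₁ 0 a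
    rw [← h2, ← h3]
    ring
  refine ⟨E, hE, ?_, heE⟩
  have hexp : ContinuousAt (fun a => NormedSpace.exp (-Y a)) 0 := by
    refine ContinuousAt.comp (g := NormedSpace.exp) ?_ hY.continuousAt.neg
    exact (NormedSpace.exp_analytic (𝕂 := ℂ) (-Y 0)).continuousAt
  have hL : Tendsto (fun a => E a * ℓ (NormedSpace.exp (-Y a))) (𝓝[≠] 0) (𝓝 (E 0)) := by
    have : Tendsto (fun a => E a * ℓ (NormedSpace.exp (-Y a))) (𝓝 0)
        (𝓝 (E 0 * ℓ (NormedSpace.exp (-Y 0)))) :=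
      hE.continuousAt.mul (ℓ.continuous.continuousAt.comp hexp)
    rw [hY0, neg_zero, NormedSpace.exp_zero, h1, mul_one] at this
    exact this.mono_left nhdsWithin_le_nhds
  let Q : X → X := fun y => NormedSpace.exp (-y) - 1 + y - (1 / 2 : ℂ) • (y * y)
  have hQ : Tendsto (fun a => (a ^ 2)⁻¹ • Q (Y a)) (𝓝[≠] 0) (𝓝 0) := by
    have hYt : Tendsto Y (𝓝[≠] 0) (𝓝 0) := by
      have := hY.continuousAt.tendsto
      rw [hY0] at this
      exact this.mono_left nhdsWithin_le_nhds
    obtain ⟨C, hC⟩ := (exp_neg_sub_isBigO.comp_tendsto hYt).bound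
    have hlim : Tendsto (fun a : ℂ => C * (‖a‖ * ‖V a‖ ^ 3)) (𝓝[≠] 0) (𝓝 0) := by
      have : Tendsto (fun a : ℂ => C * (‖a‖ * ‖V a‖ ^ 3)) (𝓝 0)
          (𝓝 (C * (‖(0 : ℂ)‖ * ‖V 0‖ ^ 3))) :=
        (continuous_norm.continuousAt.mul (hV.continuousAt.norm.pow 3)).const_mul C
      rw [norm_zero, zero_mul, mul_zero] at this
      exact this.mono_left nhdsWithin_le_nhds
    refine squeeze_zero_norm' ?_ hlim
    filter_upwards [hC, self_mem_nhdsWithin] with a ha ha0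
    have hapos : 0 < ‖a‖ := norm_pos_iff.2 ha0
    have ha' : ‖Q (Y a)‖ ≤ C * ‖Y a‖ ^ 3 := by simpa [Q] using ha
    rw [norm_smul, norm_inv, norm_pow, inv_mul_le_iff₀ (by positivity)]
    refine ha'.trans_eq ?_
    rw [hYV, norm_smul]
    ring
  have hRlim : Tendsto (fun a => ℓ ((a ^ 2)⁻¹ • Q (Y a)) + ℓ (V a * V a) / 2) (𝓝[≠] 0)
      (𝓝 (ℓ (v * v) / 2)) := by
    have h2 : Tendsto (fun a => ℓ ((a ^ 2)⁻¹ • Q (Y a))) (𝓝[≠] 0) (𝓝 (ℓ 0)) :=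
      (ℓ.continuous.tendsto 0).comp hQ
    have h3 : Tendsto (fun a => ℓ (V a * V a) / 2) (𝓝 0) (𝓝 (ℓ (V 0 * V 0) / 2)) :=
      (ℓ.continuous.continuousAt.comp (hV.continuousAt.mul hV.continuousAt)).div_const 2
    rw [hV0] at h3
    rw [map_zero] at h2
    simpa using h2.add (h3.mono_left nhdsWithin_le_nhds)
  refine tendsto_nhds_unique hL (hRlim.congr' ?_)
  filter_upwards [hsol.filter_mono nhdsWithin_le_nhds, self_mem_nhdsWithin] with a ha ha0
  have ha0' : a ≠ 0 := ha0
  -- As `ℓ ∘ T = ℓ`, applying `ℓ` to the equation eliminates `T`. The right side is `ℓ (Y a * Y a) /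
  -- 2` up to third order.
  have h2 : e a * ℓ (NormedSpace.exp (-Y a)) = ℓ (NormedSpace.exp (-Y a) - 1 + Y a) := by
    have := congrArg ℓ ha
    rw [hℓ, map_sub, map_smul, h1, smul_eq_mul] at this
    rw [map_add, map_sub, h1, this]
    ring
  have h3 : NormedSpace.exp (-Y a) - 1 + Y a = Q (Y a) + (a ^ 2 / 2) • (V a * V a) := by
    have : Y a * Y a = a ^ 2 • (V a * V a) := by
      rw [hYV, smul_mul_smul_comm, sq]
    simp only [Q]
    rw [this]
    module
  rw [h3, map_add, map_smul, heE] at h2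
  rw [map_smul]
  simp only [smul_eq_mul] at h2 ⊢
  field_simp
  linear_combination -2 * h2

/-- Square root singularity: if `1` is a simple eigenvalue of the compact operator `T`, with left
and right eigenvectors `ℓ` and `v`, then the small solutions of `y = T (1 - (1 - ζ²) e^{-y})` with
`ℓ y` in the right half plane are an analytic function of `ζ`. -/
theorem exists_analytic_solution (hT : IsCompactOperator T)
    (hℓ : ∀ y, ℓ (T y) = ℓ y) (hv : ℓ v = 1) (hker : ∀ y, T y = y → ∃ c : ℂ, y = c • v)
    (hTv : T v = v) (h1 : ℓ 1 = 1) {k : ℝ} (hk : 0 < k) (hk2 : ℓ (v * v) / 2 = (k : ℂ) ^ 2) :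
    ∃ Y : ℂ → X, AnalyticAt ℂ Y 0 ∧ Y 0 = 0 ∧ HasDerivAt Y ((k : ℂ)⁻¹ • v) 0 ∧
      ∀ᶠ p : X × ℂ in 𝓝 0, p.1 = T (1 - (1 - p.2 ^ 2) • NormedSpace.exp (-p.1)) →
        ‖p.2‖ ≤ 2 * p.2.re → 0 ≤ (ℓ p.1).re → p.1 = Y p.2 := by
  obtain ⟨Z, e, hZ, he, hZ0, he0, hZd, hed, hsol, huniq⟩ :=
    exists_solution_curve hT hℓ hv hker hTv h1
  obtain ⟨E, hE, hE0, heE⟩ := exists_eq_sq_mul hℓ h1 hZ he hZ0 he0 hZd hed hsol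
  have hkC : (k : ℂ) ≠ 0 := by exact_mod_cast hk.ne'
  rw [hk2] at hE0
  -- An analytic square root of `e`. Dividing by `k² = E 0` puts the argument of the power at 1,
  -- away from the branch cut; `m` has derivative `k` and is locally invertible.
  let m : ℂ → ℂ := fun a => a * (k * (E a / (k : ℂ) ^ 2) ^ (1 / 2 : ℂ))
  have hE1 : E 0 / (k : ℂ) ^ 2 = 1 := by rw [hE0, div_self (pow_ne_zero 2 hkC)]
  have hroot : AnalyticAt ℂ (fun a => (k : ℂ) * (E a / (k : ℂ) ^ 2) ^ (1 / 2 : ℂ)) 0 := by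
    refine analyticAt_const.mul ((hE.div_const).cpow analyticAt_const ?_)
    rw [hE1]
    exact Complex.one_mem_slitPlane
  have hm : AnalyticAt ℂ m 0 := analyticAt_id.mul hroot
  have hm0 : m 0 = 0 := zero_mul _
  have hmd : HasDerivAt m (k : ℂ) 0 := by
    have := (hasDerivAt_id (0 : ℂ)).mul hroot.differentiableAt.hasDerivAt
    refine this.congr_deriv ?_
    simp only [id, one_mul, zero_mul, add_zero]
    rw [hE1, Complex.one_cpow, mul_one]
  have hm2 : ∀ a, m a ^ 2 = e a := fun a => by
    have : ((E a / (k : ℂ) ^ 2) ^ (1 / 2 : ℂ)) ^ 2 = E a / (k : ℂ) ^ 2 := by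
      simp
    simp only [m]
    rw [mul_pow, mul_pow, this, heE]
    field_simp
  have hmd' : deriv m 0 ≠ 0 := by rwa [hmd.deriv]
  let n : ℂ → ℂ := hm.hasStrictDerivAt.localInverse _ _ _ hmd'
  have hn : AnalyticAt ℂ n 0 := by
    have := hm.analyticAt_localInverse hmd'
    rwa [hm0] at this
  have hnd : HasDerivAt n (k : ℂ)⁻¹ 0 := by
    have := (hm.hasStrictDerivAt.to_localInverse hmd').hasDerivAt
    rw [hm0] at this
    exact this.congr_deriv (by rw [hmd.deriv])
  have hnm : ∀ᶠ a in 𝓝 0, n (m a) = a := HasStrictDerivAt.eventually_left_inverse _ hmd'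
  have hn0 : n 0 = 0 := by
    have := hnm.self_of_nhds
    rwa [hm0] at this
  have hZn : AnalyticAt ℂ (fun ζ => Z (n ζ)) 0 := by
    refine AnalyticAt.comp (g := Z) ?_ hn
    rwa [hn0]
  refine ⟨fun ζ => Z (n ζ), hZn, by simp only [hn0, hZ0], ?_, ?_⟩
  · refine HasDerivAt.scomp (0 : ℂ) (g₁ := Z) (h := n) ?_ hnd
    rwa [hn0]
  · have hsmall : ∀ᶠ ζ : ℂ in 𝓝 0, ‖n ζ - (k : ℂ)⁻¹ * ζ‖ ≤ k⁻¹ / 4 * ‖ζ‖ := by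
      have := (hasDerivAt_iff_isLittleO_nhds_zero.1 hnd).bound (c := k⁻¹ / 4) (by positivity)
      filter_upwards [this] with ζ hζ
      simpa [hn0, mul_comm] using hζ
    have hneg : Tendsto (fun p : X × ℂ => -p.2) (𝓝 0) (𝓝 0) := by
      have : Tendsto (fun p : X × ℂ => -p.2) (𝓝 0) (𝓝 (-(0 : X × ℂ).2)) :=
        continuous_snd.neg.tendsto 0
      simpa using this
    have hsq : Tendsto (fun p : X × ℂ => (p.1, p.2 ^ 2)) (𝓝 0) (𝓝 0) := by
      have : Tendsto (fun p : X × ℂ => (p.1, p.2 ^ 2)) (𝓝 0)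
          (𝓝 ((0 : X × ℂ).1, (0 : X × ℂ).2 ^ 2)) :=
        (continuous_fst.prodMk (continuous_snd.pow 2)).tendsto 0
      simpa [← Prod.zero_eq_mk] using this
    have hℓt : Tendsto (fun p : X × ℂ => ℓ p.1) (𝓝 0) (𝓝 0) := by
      have : Tendsto (fun p : X × ℂ => ℓ p.1) (𝓝 0) (𝓝 (ℓ (0 : X × ℂ).1)) :=
        (ℓ.continuous.comp continuous_fst).tendsto 0
      simpa using this
    filter_upwards [hsq.eventually huniq, hneg.eventually hsmall, hℓt.eventually hnm]
      with p hp hpn hpm hsol hre hpos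
    obtain ⟨hp1, hp2⟩ := hp hsol
    rw [← hm2] at hp2
    rcases sq_eq_sq_iff_eq_or_eq_neg.1 hp2 with h | h
    · rw [h] at hpm
      rw [hpm, hp1]
    · rw [h] at hpm
      rw [hpm, norm_neg] at hpn
      -- The wrong sign would give `ℓ y ≈ -ζ / k`. With `Re ℓ y ≥ 0` and `‖ζ‖ ≤ 2 Re ζ`, the error
      -- constant `1/4` leaves only `ζ = 0`.
      have h3 : (ℓ p.1 - (k : ℂ)⁻¹ * -p.2).re ≤ k⁻¹ / 4 * ‖p.2‖ := (Complex.re_le_norm _).trans hpn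
      have h4 : ((k : ℂ)⁻¹ * -p.2).re = -(k⁻¹ * p.2.re) := by
        rw [← Complex.ofReal_inv, Complex.re_ofReal_mul, Complex.neg_re]
        ring
      rw [Complex.sub_re, h4] at h3
      have hki : 0 < k⁻¹ := inv_pos.2 hk
      have h5 : p.2 = 0 := by
        by_contra h6
        have h7 : 0 < ‖p.2‖ := norm_pos_iff.2 h6
        have h8 : k⁻¹ * ‖p.2‖ ≤ k⁻¹ * (2 * p.2.re) := by gcongr
        have h9 : 0 < k⁻¹ * ‖p.2‖ := mul_pos hki h7
        nlinarith
      rw [h5, neg_zero] at hpm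
      rw [h5, hpm, hp1]

end SquareRoot

/-! ### Application to the age operator. -/

section Main

variable {π : Measure ℝ≥0} [IsProbabilityMeasure π] [HasFiniteMean π] {θ : C(ℝ≥0∞, ℝ)}

/-- The functional `y ↦ ∫ y θ dπ` on `C([0, ∞], ℂ)`. -/
noncomputable def pairing (π : Measure ℝ≥0) [IsProbabilityMeasure π] (θ : C(ℝ≥0∞, ℝ)) :
    C(ℝ≥0∞, ℂ) →L[ℂ] ℂ :=
  LinearMap.mkContinuous
    { toFun := fun y => ∫ u : ℝ≥0, y u * θ u ∂π
      map_add' := fun y w => by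
        have hi : ∀ y : C(ℝ≥0∞, ℂ), Integrable (fun u : ℝ≥0 => y u * θ u) π := fun y =>
          integrable_continuousMap π (y * (⟨_, Complex.continuous_ofReal.comp θ.continuous⟩ :
            C(ℝ≥0∞, ℂ)))
        rw [← integral_add (hi y) (hi w)]
        congr 1
        funext u
        rw [ContinuousMap.add_apply, add_mul]
      map_smul' := fun c y => by
        rw [RingHom.id_apply, smul_eq_mul, ← integral_const_mul]
        congr 1
        funext u
        rw [ContinuousMap.smul_apply, smul_eq_mul, mul_assoc] }
    ‖θ‖ fun y => by
      refine (norm_integral_le_of_norm_le_const (C := ‖θ‖ * ‖y‖) (ae_of_all _ fun u => ?_)).trans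
        (by simp)
      rw [norm_mul, Complex.norm_real, mul_comm]
      gcongr
      · exact θ.norm_coe_le_norm _
      · exact y.norm_coe_le_norm _

omit [HasFiniteMean π] in
theorem pairing_apply (y : C(ℝ≥0∞, ℂ)) : pairing π θ y = ∫ u : ℝ≥0, y u * θ u ∂π := rfl

theorem exp_continuousMap_apply (y : C(ℝ≥0∞, ℂ)) (s : ℝ≥0∞) :
    NormedSpace.exp y s = Complex.exp (y s) := by
  have := NormedSpace.map_exp_of_mem_ball (𝕂 := ℂ) (ContinuousMap.evalAlgHom ℂ ℂ s)
    (continuous_eval_const s) y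
    (by rw [NormedSpace.expSeries_radius_eq_top]; exact edist_lt_top _ _)
  rw [Complex.exp_eq_exp_ℂ]
  exact this

/-- `θ` as a complex-valued function. -/
noncomputable def complexify (θ : C(ℝ≥0∞, ℝ)) : C(ℝ≥0∞, ℂ) :=
  ⟨fun s => (θ s : ℂ), Complex.continuous_ofReal.comp θ.continuous⟩

@[simp]
theorem complexify_apply (s : ℝ≥0∞) : complexify θ s = (θ s : ℂ) := rfl

theorem sqrt_two_mul_phi {b t : ℝ} (hb : 0 < b) (ht : 0 < t) :
    (√(t / (2 * b ^ 2)))⁻¹ * b⁻¹ = √(2 * t⁻¹) := by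
  rw [← Real.sqrt_inv]
  conv_lhs => rw [← Real.sqrt_sq (inv_pos.2 hb).le]
  rw [← Real.sqrt_mul (by positivity)]
  congr 1
  field_simp

theorem re_cpow_half_nonneg (w : ℂ) : 0 ≤ (w ^ (1 / 2 : ℂ)).re := by
  rcases eq_or_ne w 0 with rfl | hw
  · simp
  · rw [Complex.cpow_def_of_ne_zero hw, Complex.exp_re]
    refine mul_nonneg (Real.exp_nonneg _) (Real.cos_nonneg_of_mem_Icc ?_)
    have h1 : (Complex.log w * (1 / 2)).im = Complex.arg w / 2 := by
      rw [show (1 / 2 : ℂ) = ((1 / 2 : ℝ) : ℂ) by norm_num, Complex.im_mul_ofReal, Complex.log_im]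
      ring
    rw [h1]
    constructor <;> linarith [Complex.neg_pi_lt_arg w, Complex.arg_le_pi w]

theorem cpow_half_sq (w : ℂ) : (w ^ (1 / 2 : ℂ)) ^ 2 = w := by simp

/-- The principal root of a number in the right half plane has argument at most `π / 4` in absolute
value. -/
theorem norm_cpow_half_le {w : ℂ} (hw : 0 ≤ w.re) :
    ‖w ^ (1 / 2 : ℂ)‖ ≤ 2 * (w ^ (1 / 2 : ℂ)).re := by
  set ζ := w ^ (1 / 2 : ℂ) with hζ
  have h0 : 0 ≤ ζ.re := re_cpow_half_nonneg w
  have h1 : 0 ≤ ζ.re * ζ.re - ζ.im * ζ.im := by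
    rw [← cpow_half_sq w, ← hζ, sq, Complex.mul_re] at hw
    exact hw
  refine abs_le_of_sq_le_sq' ?_ (by linarith) |>.2
  rw [Complex.sq_norm, Complex.normSq_apply]
  nlinarith

theorem norm_cpow_half (w : ℂ) : ‖w ^ (1 / 2 : ℂ)‖ ^ 2 = ‖w‖ := by
  rw [← norm_pow, cpow_half_sq]

/-- The generating functions near `z = 1` are given by a function of `√(1 - z)` with values in
`C([0, ∞], ℂ)`. -/
theorem IsPositiveEigenfunction.exists_analytic (hπ : AgeCritical π)
    (hθ : IsPositiveEigenfunction π θ) :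
    ∃ H : ℂ → C(ℝ≥0∞, ℂ), AnalyticAt ℂ H 0 ∧ H 0 = 1 ∧
      HasDerivAt H (-((√(2 * phi π θ) : ℝ) : ℂ) • complexify θ) 0 ∧
      ∀ᶠ z in 𝓝[Metric.ball (0 : ℂ) 1] 1, ∀ s,
        genFun (treeLawFrom π s) z = H ((1 - z) ^ (1 / 2 : ℂ)) s := by
  set b := ∫ u : ℝ≥0, θ u ^ 2 ∂π with hb
  set t := ∫ u : ℝ≥0, θ u ^ 3 ∂π with ht
  have hbpos : 0 < b := hθ.integral_pow_pos two_ne_zero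
  have htpos : 0 < t := hθ.integral_pow_pos three_ne_zero
  have hbC : (b : ℂ) ≠ 0 := by exact_mod_cast hbpos.ne'
  let ℓ := pairing π θ
  -- Normalised by `ℓ v = 1`. Then `ℓ (v * v) / 2 = t / (2 b²)`, which is `k²`, and `v / k = √(2φ)
  -- θ`.
  let v : C(ℝ≥0∞, ℂ) := (b : ℂ)⁻¹ • complexify θ
  let k : ℝ := √(t / (2 * b ^ 2))
  have hk : 0 < k := Real.sqrt_pos.2 (by positivity)
  have hℓθ : ∀ n : ℕ, ℓ (complexify θ ^ n) = ((∫ u : ℝ≥0, θ u ^ (n + 1) ∂π : ℝ) : ℂ) := fun n => by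
    rw [pairing_apply, ← integral_complex_ofReal]
    congr 1
    funext u
    rw [ContinuousMap.pow_apply, complexify_apply, pow_succ]
    push_cast
    rfl
  have hℓ : ∀ y, ℓ (ageCLM π y) = ℓ y := fun y =>
    hθ.integral_ageOp_mul (aestronglyMeasurable_coe π y.continuous)
      fun u => y.norm_coe_le_norm u
  have hv : ℓ v = 1 := by
    have := hℓθ 1
    rw [pow_one] at this
    rw [map_smul, this, smul_eq_mul]
    exact inv_mul_cancel₀ hbC
  have hTθ : ageCLM π (complexify θ) = complexify θ := by
    ext s
    rw [ageCLM_apply]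
    simp_rw [complexify_apply]
    rw [ageOp_ofReal, hθ.ageOp_eq]
  have hTv : ageCLM π v = v := by rw [map_smul, hTθ]
  have hker : ∀ y, ageCLM π y = y → ∃ c : ℂ, y = c • v := fun y hy => by
    refine ⟨(∫ u : ℝ≥0, y u ∂π) * b, ?_⟩
    ext s
    rw [hθ.eq_smul_of_ageCLM_eq hπ hy s]
    simp only [v, ContinuousMap.smul_apply, smul_eq_mul, complexify_apply]
    field_simp
  have h1 : ℓ 1 = 1 := by
    have := hℓθ 0
    rw [pow_zero] at this
    rw [this]
    simp [hθ.integral_eq_one]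
  have hk2 : ℓ (v * v) / 2 = (k : ℂ) ^ 2 := by
    have h2 : ℓ (v * v) = (b : ℂ)⁻¹ * (b : ℂ)⁻¹ * t := by
      have := hℓθ 2
      rw [smul_mul_smul_comm, map_smul, ← sq (complexify θ), this, smul_eq_mul]
    rw [h2, ← Complex.ofReal_pow, Real.sq_sqrt (by positivity)]
    push_cast
    field_simp
  obtain ⟨Y, hY, hY0, hYd, huniq⟩ := exists_analytic_solution (isCompactOperator_ageCLM π) hℓ hv
    hker hTv h1 hk hk2
  have hcoef : (k : ℂ)⁻¹ • v = ((√(2 * phi π θ) : ℝ) : ℂ) • complexify θ := by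
    rw [smul_smul, phi, ← ht, ← sqrt_two_mul_phi hbpos htpos]
    push_cast
    rfl
  rw [hcoef] at hYd
  have hexp : AnalyticAt ℂ (fun ζ => NormedSpace.exp (-Y ζ)) 0 :=
    AnalyticAt.comp (g := NormedSpace.exp) (f := fun ζ => -Y ζ) (NormedSpace.exp_analytic _) hY.neg
  have hexpd : HasDerivAt (fun ζ => NormedSpace.exp (-Y ζ))
      (-(((√(2 * phi π θ) : ℝ) : ℂ) • complexify θ)) 0 := by
    have h2 : HasFDerivAt (NormedSpace.exp : C(ℝ≥0∞, ℂ) → C(ℝ≥0∞, ℂ))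
        (1 : C(ℝ≥0∞, ℂ) →L[ℂ] C(ℝ≥0∞, ℂ)) (-Y 0) := by
      rw [hY0, neg_zero]
      exact hasFDerivAt_exp_zero
    exact HasFDerivAt.comp_hasDerivAt (0 : ℂ) (l := NormedSpace.exp) (f := fun ζ => -Y ζ) h2
      hYd.neg
  refine ⟨fun ζ => (1 - ζ ^ 2) • NormedSpace.exp (-Y ζ),
    (analyticAt_const.sub (analyticAt_id.pow 2)).smul hexp, by simp [hY0], ?_, ?_⟩
  · have h2 : HasDerivAt (fun ζ : ℂ => 1 - ζ ^ 2) 0 0 := by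
      simpa using ((hasDerivAt_id (0 : ℂ)).pow 2).const_sub 1
    refine (h2.smul hexpd).congr_deriv ?_
    simp
  · obtain ⟨δ, hδ, hball⟩ := Metric.eventually_nhds_iff_ball.1 huniq
    have hζ : ∀ᶠ z : ℂ in 𝓝[Metric.ball 0 1] 1, ‖(1 - z) ^ (1 / 2 : ℂ)‖ < δ := by
      have : ∀ᶠ z : ℂ in 𝓝 1, ‖1 - z‖ < δ ^ 2 := by
        have hc : Tendsto (fun z : ℂ => ‖1 - z‖) (𝓝 1) (𝓝 ‖(1 : ℂ) - 1‖) :=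
          (continuous_const.sub continuous_id).norm.tendsto 1
        rw [sub_self, norm_zero] at hc
        exact hc.eventually_lt_const (by positivity)
      filter_upwards [this.filter_mono nhdsWithin_le_nhds] with z hz
      rw [← norm_cpow_half] at hz
      exact lt_of_pow_lt_pow_left₀ 2 hδ.le hz
    filter_upwards [hζ, eventually_norm_lt_one, hθ.eventually_exists_small_solution hδ]
      with z hzδ hz1 hsmall s
    obtain ⟨y, hyδ, hyg, hyeq, hyre⟩ := hsmall
    have hsq : 1 - ((1 - z) ^ (1 / 2 : ℂ)) ^ 2 = z := by
      rw [cpow_half_sq]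
      ring
    have hmain : y = Y ((1 - z) ^ (1 / 2 : ℂ)) := by
      refine hball (y, (1 - z) ^ (1 / 2 : ℂ)) ?_ ?_ ?_ ?_
      · rw [mem_ball_zero_iff, Prod.norm_def]
        exact max_lt hyδ hzδ
      · simp only
        rw [hsq]
        ext s
        rw [ageCLM_apply, hyeq s]
        congr 1
        funext u
        simp [exp_continuousMap_apply]
      · refine norm_cpow_half_le ?_
        rw [Complex.sub_re, Complex.one_re, sub_nonneg]
        exact (Complex.re_le_norm z).trans hz1.le
      · have hi : Integrable (fun u : ℝ≥0 => y u * θ u) π :=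
          integrable_continuousMap π (y * complexify θ)
        change 0 ≤ Complex.reCLM (∫ u : ℝ≥0, y u * θ u ∂π)
        rw [← ContinuousLinearMap.integral_comp_comm _ hi]
        refine integral_nonneg fun u => ?_
        rw [Complex.reCLM_apply, Complex.re_mul_ofReal]
        exact mul_nonneg (hyre u) (hθ.nonneg u)
    rw [hyg s, ContinuousMap.smul_apply, hsq, ← hmain, exp_continuousMap_apply]
    rfl

/-- The difference quotient `dslope f 0` is itself analytic, so it differs from its value at 0 by
`O(ζ)`. -/
theorem _root_.AnalyticAt.exists_norm_sub_sub_smul_le {E : Type*} [NormedAddCommGroup E] [NormedSpace ℂ E]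
    {f : ℂ → E} {f' : E} (hf : AnalyticAt ℂ f 0) (hd : HasDerivAt f f' 0) :
    ∃ C, ∀ᶠ ζ in 𝓝 0, ‖f ζ - f 0 - ζ • f'‖ ≤ C * ‖ζ‖ ^ 2 := by
  have h1 := analyticAt_dslope hf
  have h2 := h1.differentiableAt.isBigO_sub
  obtain ⟨C, hC⟩ := h2.bound
  refine ⟨C, ?_⟩
  filter_upwards [hC] with ζ hζ
  have h3 : ζ • dslope f 0 ζ = f ζ - f 0 := by simpa using sub_smul_dslope f 0 ζ
  rw [dslope_same, hd.deriv, sub_zero] at hζ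
  rw [← h3, ← smul_sub, norm_smul, sq, ← mul_assoc, mul_comm]
  gcongr

end Main

end AgeTree

/-! ### Assembly of the theorem. -/

open AgeTree in
theorem mainTheorem7 (π : Measure ℝ≥0) [IsProbabilityMeasure π] [AgeTree.HasFiniteMean π]
    (hπ : AgeTree.AgeCritical π) :
    -- near `z = 1`, `E z^{|T_s|}` is an analytic function of the principal branch of `√(1 - z)`,
    -- continuous in `s ∈ [0, ∞]`
    (∃ r : ℝ, 0 < r ∧ ∃ h : ℝ≥0∞ → ℂ → ℂ,
      (∀ s, AnalyticOnNhd ℂ (h s) (Metric.ball 0 r)) ∧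
      ContinuousOn (fun p : ℝ≥0∞ × ℂ => h p.1 p.2) (univ ×ˢ Metric.ball 0 r) ∧
      ∀ s : ℝ≥0∞, ∀ z ∈ Metric.ball (0 : ℂ) 1 ∩ Metric.ball (1 : ℂ) (r ^ 2),
        AgeTree.genFun (AgeTree.treeLawFrom π s) z = h s ((1 - z) ^ (1 / 2 : ℂ))) ∧
    -- the principal eigenfunction exists and is unique, and it governs the expansions
    ∃ θ : ℝ≥0∞ → ℝ, AgeTree.IsPrincipalEigenfunction π θ ∧
      (∀ θ', AgeTree.IsPrincipalEigenfunction π θ' → θ' = θ) ∧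
      Integrable (fun u : ℝ≥0 => θ u ^ 3) π ∧ 0 < ∫ u : ℝ≥0, θ u ^ 3 ∂π ∧
      (∃ C : ℝ, ∀ᶠ z : ℝ in 𝓝[<] 1, ∀ s : ℝ≥0∞,
        ‖AgeTree.genFun (AgeTree.treeLawFrom π s) (z : ℂ) -
          ((1 - √(2 * AgeTree.phi π θ) * θ s * √(1 - z) : ℝ) : ℂ)‖ ≤ C * (1 - z)) ∧
      (fun z : ℝ => AgeTree.genFun (AgeTree.treeLawStat π) (z : ℂ) -
          ((1 - √(2 * AgeTree.phi π θ) * √(1 - z) : ℝ) : ℂ)) =O[𝓝[<] 1] fun z : ℝ => 1 - z := by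
  obtain ⟨θ, hθ0, hθL, hθi⟩ := exists_eigenfunction hπ
  have hθ : IsPositiveEigenfunction π θ := ⟨hθ0, hθL, hθi⟩
  obtain ⟨H, hH, hH0, hHd, hHg⟩ := hθ.exists_analytic hπ
  constructor
  · obtain ⟨r₁, hr₁, hr₁H⟩ := Metric.eventually_nhds_iff_ball.1 hH.eventually_analyticAt
    obtain ⟨r₂, hr₂, hr₂g⟩ := Metric.mem_nhdsWithin_iff.1 hHg
    -- `r₁` is a radius of analyticity in `ζ`, and `r₂` a radius of validity in `z`; since `|ζ|² =
    -- |1 - z|`, the latter enters through its square root.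
    refine ⟨min r₁ (√r₂), lt_min hr₁ (Real.sqrt_pos.2 hr₂), fun s ζ => H ζ s, fun s ζ hζ => ?_, ?_,
      fun s z hz => ?_⟩
    · have := hr₁H ζ (Metric.ball_subset_ball (min_le_left _ _) hζ)
      exact ((ContinuousMap.evalCLM ℂ s).analyticAt _).comp this
    · intro p hp
      have h1 := (hr₁H p.2 (Metric.ball_subset_ball (min_le_left _ _) hp.2)).continuousAt
      have h2 : ContinuousAt (fun q : ℝ≥0∞ × ℂ => (H q.2, q.1)) p :=
        (ContinuousAt.comp (g := H) h1 continuousAt_snd).prodMk continuousAt_fst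
      exact (ContinuousAt.comp (g := fun q : C(ℝ≥0∞, ℂ) × ℝ≥0∞ => q.1 q.2)
        continuous_eval.continuousAt h2).continuousWithinAt
    · refine hr₂g ⟨Metric.ball_subset_ball ?_ hz.2, hz.1⟩ s
      calc (min r₁ (√r₂)) ^ 2 ≤ √r₂ ^ 2 :=
            pow_le_pow_left₀ (lt_min hr₁ (Real.sqrt_pos.2 hr₂)).le (min_le_right _ _) 2
        _ = r₂ := Real.sq_sqrt hr₂.le
  · have hreal : Tendsto (fun z : ℝ => (z : ℂ)) (𝓝[<] 1) (𝓝[Metric.ball (0 : ℂ) 1] 1) := by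
      refine tendsto_nhdsWithin_iff.2 ⟨?_, ?_⟩
      · have := Complex.continuous_ofReal.tendsto 1
        rw [Complex.ofReal_one] at this
        exact this.mono_left nhdsWithin_le_nhds
      · filter_upwards [Ioo_mem_nhdsLT (show (0 : ℝ) < 1 by norm_num)] with z hz
        rw [mem_ball_zero_iff, Complex.norm_real, Real.norm_of_nonneg hz.1.le]
        exact hz.2
    have hroot : ∀ z : ℝ, z < 1 → (1 - (z : ℂ)) ^ (1 / 2 : ℂ) = ((√(1 - z) : ℝ) : ℂ) := by
      intro z hz
      rw [Real.sqrt_eq_rpow, Complex.ofReal_cpow (by linarith)]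
      push_cast
      rfl
    have hsqrt : Tendsto (fun z : ℝ => ((√(1 - z) : ℝ) : ℂ)) (𝓝[<] 1) (𝓝 0) := by
      have : Tendsto (fun z : ℝ => ((√(1 - z) : ℝ) : ℂ)) (𝓝 1) (𝓝 ((√(1 - 1) : ℝ) : ℂ)) :=
        (Complex.continuous_ofReal.comp
          (Real.continuous_sqrt.comp (continuous_const.sub continuous_id))).tendsto 1
      rw [sub_self, Real.sqrt_zero, Complex.ofReal_zero] at this
      exact this.mono_left nhdsWithin_le_nhds
    obtain ⟨C, hC⟩ := hH.exists_norm_sub_sub_smul_le hHd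
    have hbound : ∀ᶠ z : ℝ in 𝓝[<] 1, ∀ s : ℝ≥0∞,
        ‖genFun (treeLawFrom π s) (z : ℂ) -
          ((1 - √(2 * phi π θ) * θ s * √(1 - z) : ℝ) : ℂ)‖ ≤ C * (1 - z) := by
      filter_upwards [hreal.eventually hHg, hsqrt.eventually hC, self_mem_nhdsWithin]
        with z hz hzC hz1 s
      have hz1' : z < 1 := hz1
      rw [hz s, hroot z hz1']
      have hsq : ‖((√(1 - z) : ℝ) : ℂ)‖ ^ 2 = 1 - z := by
        rw [Complex.norm_real, Real.norm_eq_abs, sq_abs, Real.sq_sqrt (by linarith)]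
      rw [hsq] at hzC
      refine le_trans (le_of_eq ?_) ((ContinuousMap.norm_coe_le_norm _ s).trans hzC)
      rw [hH0]
      simp only [ContinuousMap.sub_apply, ContinuousMap.smul_apply, ContinuousMap.one_apply,
        complexify_apply, smul_eq_mul]
      congr 1
      push_cast
      ring
    refine ⟨θ, hθ.isPrincipalEigenfunction hπ,
      fun θ' h => hθ.eq_of_isPrincipalEigenfunction hπ h,
      integrable_continuousMap π (θ ^ 3), hθ.integral_pow_pos three_ne_zero, ⟨C, hbound⟩, ?_⟩
    -- The expansion for the root law `π` is the `π`-average of the one uniform in `s`, with `∫ θ dπ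
    -- = 1`.
    refine Asymptotics.IsBigO.of_bound C ?_
    filter_upwards [hbound, hreal.eventually eventually_norm_lt_one, self_mem_nhdsWithin]
      with z hz hz1 hzlt
    have hzlt' : z < 1 := hzlt
    have hgi : Integrable (fun u : ℝ≥0 => genFun (treeLawFrom π u) (z : ℂ)) π :=
      Integrable.of_bound ((measurable_genFun π hz1).comp
        measurable_coe_nnreal_ennreal).aestronglyMeasurable 1
        (ae_of_all _ fun u => norm_genFun_le_one _ hz1.le)
    have hθint := integrable_continuousMap π θ
    have hri : Integrable (fun u : ℝ≥0 =>
        ((1 - √(2 * phi π θ) * θ u * √(1 - z) : ℝ) : ℂ)) π :=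
      ((integrable_const _).sub ((hθint.const_mul _).mul_const _)).ofReal
    have hrint : ∫ u : ℝ≥0, ((1 - √(2 * phi π θ) * θ u * √(1 - z) : ℝ) : ℂ) ∂π =
        ((1 - √(2 * phi π θ) * √(1 - z) : ℝ) : ℂ) := by
      rw [integral_complex_ofReal, integral_sub (integrable_const _)
        ((hθint.const_mul _).mul_const _), integral_mul_const, integral_const_mul,
        hθ.integral_eq_one]
      simp
    rw [genFun_treeLawStat π hz1, ← hrint, ← integral_sub hgi hri,
      Real.norm_of_nonneg (by linarith : 0 ≤ 1 - z)]
    refine (norm_integral_le_of_norm_le_const (ae_of_all _ fun u : ℝ≥0 => hz u)).trans ?_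
    simp
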